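/- Let $(I,\le)$ be a poset. An $I$-system $\mathcal J$ consists of a partition $I=I_{\rm free}\sqcup I_{\rm reg}$; abelian groups $G_i$ ($i\in I$), with which one associates $M_i=\mathbb N\times G_i$, $\widehat G_i=\mathbb Z\times G_i$ for $i$ free (where $\mathbb N=\{1,2,\dots\}$) and $M_i=\widehat G_i=G_i$ for $i$ regular; and semigroup homomorphisms $\varphi_{ji}\colon M_i\to G_j$ for $i<j$, whose extensions $\widehat\varphi_{ji}\colon\widehat G_i\to G_j\subseteq\widehat G_j$ are functorial in $I$, such that for each free $i$ every element of $G_i$ is a finite sum of elements $\varphi_{ik}(x)$ with $k<i$, $x\in M_k$ (so that $G_i=0$ if $i$ is free and minimal). The monoid $M(\mathcal J)$ is $\bigsqcup_a H_a/{\sim}$, where $a$ runs over the finitely generated lower subsets of $I$; $H_a\subseteq\bigoplus_{i\in a}\widehat G_i$ consists of the families $(z_i)$ with $z_i\in M_i$ for $i$ maximal in $a$ and $z_i\in\{0\}\cup M_i$ for the other $i\in a$; $x\sim y$ in $H_a$ means that $x-y$ lies in the subgroup generated by the elements $\chi_i(u)-\chi_j(\widehat\varphi_{ji}(u))$ with $i<j$,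 $j$ maximal in $a$, $u\in\widehat G_i$ ($\chi_i(u)$ is the family with entry $u$ at $i$ and $0$ elsewhere); and the sum of the classes of $x\in H_a$ and $y\in H_b$ is the class of $x+y$ in $H_{a\cup b}$. A commutative monoid is a graph monoid if it is isomorphic, for some countable row-finite directed graph $E$, to the commutative monoid generated by the vertices of $E$ with the relations $v=\sum_{s(e)=v}r(e)$ for every vertex $v$ that emits edges. Let $I=\{p,q_1,\dots,q_r\}$, $r\ge 1$, with $q_i<p$ for all $i$ and the $q_i$ pairwise incomparable, and let $\mathcal J$ be an $I$-system with $I=I_{\rm free}$. Then $G_{q_i}=0$ for all $i$, so that $M_{q_i}=\mathbb N$, and: (a) If $r=1$, then $G_p$ is a finite cyclic group and $M(\mathcal J)$ is a graph monoid. (b) If $r>1$, then $M(\mathcal J)$ is a graph monoid if and only if there are integers $n_1,\dots,n_r>0$ and an isomorphism $G_p\cong\mathbb Z^r/\langle(n_1,\dots,n_r)\rangle$ under which each $\varphi_{p,q_i}\colon\mathbb N\to G_p$ sends the generator $1$ to the image of the canonical basis vector $e_i$. (c) Let $r>1$, $0\le s<r$ and $k_1,\dots,k_{r-s}\ge 1$.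 Let $\mathcal J$ be the $I$-system with $I=I_{\rm free}$, $G_p=\mathbb Z^s\oplus\mathbb Z_{k_1}\oplus\dots\oplus\mathbb Z_{k_{r-s}}$, where $\varphi_{p,q_i}(1)$ is the $i$-th basis vector of $\mathbb Z^s$ for $1\le i\le s$, and $\varphi_{p,q_i}(1)=(-1,\dots,-1,\overline 0,\dots,\overline 1,\dots,\overline 0)$, with $s$ entries $-1$ and with $\overline 1\in\mathbb Z_{k_{i-s}}$, for $s<i\le r$. Then $M(\mathcal J)$ is a graph monoid if and only if $s=r-1$. -/

import Mathlib

/-! ### I-systems and their monoids -/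

/-- The semigroup `M_i` attached to an abelian group `G = G_i`. Elements are written as pairs in
`ℤ × G`: in the free case (`F` holds) these are the pairs `(n, g)` with `n ≥ 1`, i.e. `ℕ × G`;
in the regular case they are the pairs `(0, g)`, i.e. a copy of `G`. -/
def semigroupPart (F : Prop) (G : Type*) [AddCommGroup G] : AddSubsemigroup (ℤ × G) where
  carrier := {x | (F → 0 < x.1) ∧ (¬ F → x.1 = 0)}
  add_mem' := by
    rintro x y ⟨hx, hx'⟩ ⟨hy, hy'⟩
    refine ⟨fun h => ?_, fun h => ?_⟩
    · have := hx h; have := hy h; simp only [Prod.fst_add]; omega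
    · have := hx' h; have := hy' h; simp only [Prod.fst_add]; omega

/-- The group `Ĝ_i`: `ℤ × G` in the free case, the pairs `(0, g)` in the regular case. -/
def groupPart (F : Prop) (G : Type*) [AddCommGroup G] : AddSubgroup (ℤ × G) where
  carrier := {x | ¬ F → x.1 = 0}
  add_mem' := by
    intro x y hx hy h
    have := hx h; have := hy h; simp only [Prod.fst_add]; omega
  zero_mem' := fun _ => rfl
  neg_mem' := by
    intro x hx h
    have := hx h; simp only [Prod.fst_neg]; omega

/-- The inclusion `G_i → Ĝ_i`, `g ↦ (0, g)`. -/
def inclGroupPart (F : Prop) {G : Type*} [AddCommGroup G] (g : G) : groupPart F G :=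
  ⟨(0, g), fun _ => rfl⟩

open Classical in
/-- Every `u ∈ Ĝ_i` is a difference of two elements of `M_i`; this is the first one. -/
noncomputable def posRep {F : Prop} {G : Type*} [AddCommGroup G] (u : groupPart F G) :
    semigroupPart F G :=
  ⟨(max u.1.1 0 + (if F then 1 else 0), u.1.2), by
    refine ⟨fun h => ?_, fun h => ?_⟩
    · simp only [h, if_true]; omega
    · have := u.2 h; simp [h, this]⟩

open Classical in
/-- The second element of the difference. -/
noncomputable def negRep {F : Prop} {G : Type*} [AddCommGroup G] (u : groupPart F G) :
    semigroupPart F G :=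
  ⟨(max (-u.1.1) 0 + (if F then 1 else 0), 0), by
    refine ⟨fun h => ?_, fun h => ?_⟩
    · simp only [h, if_true]; omega
    · have := u.2 h; simp [h, this]⟩

theorem posRep_sub_negRep {F : Prop} {G : Type*} [AddCommGroup G] (u : groupPart F G) :
    ((posRep u : semigroupPart F G) : ℤ × G) - (negRep u : semigroupPart F G) = u := by
  ext
  · simp only [posRep, negRep, Prod.fst_sub]; omega
  · simp [posRep, negRep]

theorem map_sub_map_eq {F : Prop} {G A : Type*} [AddCommGroup G] [AddCommGroup A]
    (φ : semigroupPart F G →ₙ+ A) (x y x' y' : semigroupPart F G)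
    (h : (x : ℤ × G) - y = x' - y') : φ x - φ y = φ x' - φ y' := by
  have h1 : x + y' = x' + y := by
    apply Subtype.ext
    simp only [AddMemClass.coe_add]
    exact sub_eq_sub_iff_add_eq_add.mp h
  have h2 := congrArg φ h1
  rw [map_add, map_add] at h2
  exact sub_eq_sub_iff_add_eq_add.mpr h2

/-- The unique extension `φ̂ : Ĝ_i → A` of a semigroup homomorphism `φ : M_i → A` into an abelian
group to a group homomorphism. -/
noncomputable def hatExtension {F : Prop} {G A : Type*} [AddCommGroup G] [AddCommGroup A]
    (φ : semigroupPart F G →ₙ+ A) : groupPart F G →+ A :=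
  AddMonoidHom.mk' (fun u => φ (posRep u) - φ (negRep u)) (by
    intro u v
    have key := map_sub_map_eq φ (posRep (u + v)) (negRep (u + v))
      (posRep u + posRep v) (negRep u + negRep v) (by
        rw [posRep_sub_negRep]
        simp only [AddMemClass.coe_add]
        rw [add_sub_add_comm, posRep_sub_negRep, posRep_sub_negRep])
    rw [key, map_add, map_add, add_sub_add_comm])

/-- `φ̂` extends `φ`. -/
theorem hatExtension_apply_coe {F : Prop} {G A : Type*} [AddCommGroup G] [AddCommGroup A]
    (φ : semigroupPart F G →ₙ+ A) (u : groupPart F G) (x : semigroupPart F G)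
    (h : (u : ℤ × G) = x) : hatExtension φ u = φ x := by
  have key := map_sub_map_eq φ (posRep u) (negRep u) (x + x) x (by
    rw [posRep_sub_negRep, h]; simp)
  change φ (posRep u) - φ (negRep u) = φ x
  rw [key, map_add, add_sub_cancel_right]

/-- An `I`-system over a poset `I`: a partition of `I` into free and regular elements
(`free` is the set of free ones, its complement the set of regular ones), abelian groups `G i`,
and semigroup homomorphisms `φ_{ji} : M_i → G_j` for `i < j`. -/
structure ISystem.{u, v} (I : Type u) [PartialOrder I] where
  free : Set I
  G : I → Type v
  [grp : ∀ i, AddCommGroup (G i)]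
  φ : ∀ {i j : I}, i < j → (semigroupPart (i ∈ free) (G i) →ₙ+ G j)
  /-- Functoriality of `i ↦ Ĝ_i`, `(i < j) ↦ φ̂_{ji}`, where `φ̂_{ji}` is regarded as a map into `Ĝ_j`
  through `g ↦ (0, g)`. -/
  comp : ∀ {i j k : I} (hij : i < j) (hjk : j < k) (u : groupPart (i ∈ free) (G i)),
    hatExtension (φ hjk) (inclGroupPart (j ∈ free) (hatExtension (φ hij) u)) =
      hatExtension (φ (hij.trans hjk)) u
  /-- For `i` free, `⨁_{k < i} φ_{ik}` is onto `G_i`: every element of `G_i` is a finite sum of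
  elements `φ_{ik}(x)` with `k < i` and `x ∈ M_k`. The empty sum is allowed, which matters only for
  minimal `i`, whose group has to be trivial. -/
  surj : ∀ i ∈ free,
    AddSubmonoid.closure {y : G i | ∃ (k : I) (h : k < i) (x : semigroupPart (k ∈ free) (G k)),
      φ h x = y} = ⊤

attribute [instance] ISystem.grp

/-- The finitely generated lower subsets of a poset. -/
structure FGLowerSet (I : Type*) [PartialOrder I] where
  set : LowerSet I
  fg : ∃ s : Set I, s.Finite ∧ set = lowerClosure s

theorem FGLowerSet.ext_set {I : Type*} [PartialOrder I] {a b : FGLowerSet I}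
    (h : a.set = b.set) : a = b := by
  cases a; cases b; cases h; rfl

/-- Union of finitely generated lower sets, written `+`. -/
instance FGLowerSet.instAdd {I : Type*} [PartialOrder I] : Add (FGLowerSet I) :=
  ⟨fun a b => ⟨a.set ⊔ b.set, by
    obtain ⟨s, hs, ha⟩ := a.fg
    obtain ⟨t, ht, hb⟩ := b.fg
    exact ⟨s ∪ t, hs.union ht, by rw [ha, hb, lowerClosure_union]⟩⟩⟩

/-- The empty lower set, written `0`. -/
instance FGLowerSet.instZero {I : Type*} [PartialOrder I] : Zero (FGLowerSet I) :=
  ⟨⟨⊥, ∅, Set.finite_empty, lowerClosure_empty.symm⟩⟩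

/-- The semilattice `A(I)` of finitely generated lower sets under union. -/
instance FGLowerSet.instAddCommMonoid {I : Type*} [PartialOrder I] :
    AddCommMonoid (FGLowerSet I) where
  add_assoc a b c := FGLowerSet.ext_set (sup_assoc a.set b.set c.set)
  add_comm a b := FGLowerSet.ext_set (sup_comm a.set b.set)
  zero_add a := FGLowerSet.ext_set (bot_sup_eq a.set)
  add_zero a := FGLowerSet.ext_set (sup_bot_eq a.set)
  nsmul := nsmulRec

theorem FGLowerSet.set_add {I : Type*} [PartialOrder I] (a b : FGLowerSet I) :
    (a + b).set = a.set ⊔ b.set := rfl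

theorem FGLowerSet.set_zero {I : Type*} [PartialOrder I] :
    (0 : FGLowerSet I).set = ⊥ := rfl

/-- `i` is a maximal element of the lower set `a`. -/
def FGLowerSet.IsMax {I : Type*} [PartialOrder I] (a : FGLowerSet I) (i : I) : Prop :=
  Maximal (· ∈ a.set) i

theorem FGLowerSet.exists_isMax {I : Type*} [PartialOrder I] (a : FGLowerSet I) {i : I}
    (hi : i ∈ a.set) : ∃ j, i ≤ j ∧ a.IsMax j := by
  obtain ⟨s, hs, ha⟩ := a.fg
  rw [ha, mem_lowerClosure] at hi
  obtain ⟨t, hts, hit⟩ := hi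
  obtain ⟨m, htm, hm⟩ := hs.exists_le_maximal hts
  refine ⟨m, hit.trans htm, ?_, ?_⟩
  · change m ∈ a.set
    rw [ha]
    exact subset_lowerClosure hm.1
  · intro y hy hmy
    change y ∈ a.set at hy
    rw [ha, mem_lowerClosure] at hy
    obtain ⟨z, hz, hyz⟩ := hy
    exact hyz.trans (hm.2 hz (hmy.trans hyz))

namespace ISystem

variable {I : Type*} [PartialOrder I]

/-- The semigroup `M_i`. -/
abbrev Mi (J : ISystem I) (i : I) : AddSubsemigroup (ℤ × J.G i) :=
  semigroupPart (i ∈ J.free) (J.G i)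

/-- The group `Ĝ_i`. -/
abbrev Ghat (J : ISystem I) (i : I) : AddSubgroup (ℤ × J.G i) :=
  groupPart (i ∈ J.free) (J.G i)

/-- The element `(1, 0)` of `M_i = ℕ × G_i`, for `i` free. -/
def gen (J : ISystem I) (i : I) (h : i ∈ J.free) : J.Mi i :=
  ⟨(1, 0), fun _ => Int.one_pos, fun h' => absurd h h'⟩

/-- The direct sum of all `ℤ × G_i`. All groups `Ĥ_a = ⨁_{i ∈ a} Ĝ_i` are regarded as subgroups
of it (extension by zero), so that the maps `f_a^b` are inclusions. -/
abbrev Ambient (J : ISystem I) := Π₀ i : I, ℤ × J.G i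

open Classical in
/-- The subgroup `U_a`, generated by the elements `χ(a,i,u) - χ(a,j,φ̂_{ji}(u))` with
`i < j ∈ Max(a)` and `u ∈ Ĝ_i`. -/
def U (J : ISystem I) (a : FGLowerSet I) : AddSubgroup J.Ambient :=
  AddSubgroup.closure {z | ∃ (i j : I) (h : i < j) (_ : a.IsMax j) (u : J.Ghat i),
    z = DFinsupp.single i (u : ℤ × J.G i) -
      DFinsupp.single j ((0 : ℤ), hatExtension (J.φ h) u)}

/-- The subset `H_a` of `Ĥ_a`: the families supported in `a` whose entry lies in `M_i` for `i`
maximal in `a`, and in `{0} ∪ M_i` for the other `i` in `a`. (For `i` regular, `M_i = Ĝ_i`, so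
there is no condition on that entry.) -/
def H (J : ISystem I) (a : FGLowerSet I) : Set J.Ambient :=
  {z | (∀ i, i ∉ a.set → z i = 0) ∧ (∀ i, a.IsMax i → z i ∈ J.Mi i) ∧
    (∀ i ∈ a.set, z i = 0 ∨ z i ∈ J.Mi i)}

theorem U_mono (J : ISystem I) {a b : FGLowerSet I} (hab : a.set ≤ b.set) : J.U a ≤ J.U b := by
  classical
  refine (AddSubgroup.closure_le _).2 ?_
  rintro z ⟨i, j, h, hj, u, rfl⟩
  obtain ⟨k, hjk, hk⟩ := b.exists_isMax (hab hj.1)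
  rcases hjk.eq_or_lt with rfl | hjk
  · exact AddSubgroup.subset_closure ⟨i, j, h, hk, u, by congr!⟩
  · have h1 : DFinsupp.single i (u : ℤ × J.G i) -
        DFinsupp.single k ((0 : ℤ), hatExtension (J.φ (h.trans hjk)) u) ∈ J.U b :=
      AddSubgroup.subset_closure ⟨i, k, h.trans hjk, hk, u, by congr!⟩
    have h2 : DFinsupp.single j ((0 : ℤ), hatExtension (J.φ h) u) -
        DFinsupp.single k ((0 : ℤ), hatExtension (J.φ (h.trans hjk)) u) ∈ J.U b := by
      refine AddSubgroup.subset_closure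
        ⟨j, k, hjk, hk, inclGroupPart (j ∈ J.free) (hatExtension (J.φ h) u), ?_⟩
      rw [J.comp h hjk u]
      simp only [inclGroupPart]
    have h3 := (J.U b).sub_mem h1 h2
    rw [sub_sub_sub_cancel_right] at h3
    exact h3

theorem H_add (J : ISystem I) {a b : FGLowerSet I} {x y : J.Ambient}
    (hx : x ∈ J.H a) (hy : y ∈ J.H b) : x + y ∈ J.H (a + b) := by
  classical
  obtain ⟨hx0, hx1, hx2⟩ := hx
  obtain ⟨hy0, hy1, hy2⟩ := hy
  have hx3 : ∀ i, x i = 0 ∨ x i ∈ J.Mi i := fun i =>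
    if h : i ∈ a.set then hx2 i h else Or.inl (hx0 i h)
  have hy3 : ∀ i, y i = 0 ∨ y i ∈ J.Mi i := fun i =>
    if h : i ∈ b.set then hy2 i h else Or.inl (hy0 i h)
  refine ⟨fun i hi => ?_, fun i hi => ?_, fun i _ => ?_⟩
  · rw [FGLowerSet.set_add, LowerSet.mem_sup_iff, not_or] at hi
    rw [DFinsupp.add_apply, hx0 i hi.1, hy0 i hi.2, add_zero]
  · rw [DFinsupp.add_apply]
    have hi1 : i ∈ a.set ∨ i ∈ b.set := LowerSet.mem_sup_iff.1 hi.1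
    rcases hi1 with h | h
    · have hm := hx1 i ⟨h, fun z hz hiz => hi.2 (LowerSet.mem_sup_iff.2 (Or.inl hz)) hiz⟩
      rcases hy3 i with h0 | h0
      · rw [h0, add_zero]; exact hm
      · exact (J.Mi i).add_mem hm h0
    · have hm := hy1 i ⟨h, fun z hz hiz => hi.2 (LowerSet.mem_sup_iff.2 (Or.inr hz)) hiz⟩
      rcases hx3 i with h0 | h0
      · rw [h0, zero_add]; exact hm
      · exact (J.Mi i).add_mem h0 hm
  · rw [DFinsupp.add_apply]
    rcases hx3 i with h | h
    · rw [h, zero_add]; exact hy3 i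
    · rcases hy3 i with h' | h'
      · rw [h', add_zero]; exact Or.inr h
      · exact Or.inr ((J.Mi i).add_mem h h')

/-- The disjoint union of the `H_a`, `a ∈ A(I)`, with `(a, x) + (b, y) = (a ∪ b, x + y)`. -/
def preMonoid (J : ISystem I) : AddSubmonoid (FGLowerSet I × J.Ambient) where
  carrier := {w | w.2 ∈ J.H w.1}
  add_mem' := fun hx hy => J.H_add hx hy
  zero_mem' := by
    refine ⟨fun i _ => rfl, fun i hi => ?_, fun i _ => Or.inl rfl⟩
    exact absurd hi.1 (LowerSet.notMem_bot)

/-- The congruence: `x ∼ y` iff `x, y` lie in the same `H_a` and `x - y ∈ U_a`. -/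
def con (J : ISystem I) : AddCon J.preMonoid where
  r w w' := w.1.1 = w'.1.1 ∧ w.1.2 - w'.1.2 ∈ J.U w.1.1
  iseqv :=
    { refl := fun w => ⟨rfl, by rw [sub_self]; exact (J.U _).zero_mem⟩
      symm := fun {w w'} h => ⟨h.1.symm, by
        rw [← h.1, ← neg_sub]; exact (J.U _).neg_mem h.2⟩
      trans := fun {w w' w''} h h' => ⟨h.1.trans h'.1, by
        have h2 := h'.2
        rw [← h.1] at h2
        have h3 := (J.U _).add_mem h.2 h2
        rwa [sub_add_sub_cancel] at h3⟩ }
  add' := by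
    rintro w x y z ⟨h1, h2⟩ ⟨h3, h4⟩
    refine ⟨?_, ?_⟩
    · change w.1.1 + y.1.1 = x.1.1 + z.1.1
      rw [h1, h3]
    · change w.1.2 + y.1.2 - (x.1.2 + z.1.2) ∈ J.U (w.1.1 + y.1.1)
      rw [add_sub_add_comm]
      exact (J.U _).add_mem
        (J.U_mono (a := w.1.1) le_sup_left h2) (J.U_mono (a := y.1.1) le_sup_right h4)

/-- The monoid `M(J) = ⊔_{a ∈ A(I)} H_a / ∼` of the `I`-system `J`. -/
abbrev Monoid (J : ISystem I) := J.con.Quotient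

end ISystem

/-! ### Graph monoids -/

/-- A countable row-finite directed graph. -/
structure RowFiniteGraph where
  Vertex : Type
  Edge : Type
  countable_vertex : Countable Vertex
  countable_edge : Countable Edge
  src : Edge → Vertex
  rng : Edge → Vertex
  row_finite : ∀ v, {e | src e = v}.Finite

namespace RowFiniteGraph

/-- The defining relations `v = ∑_{s(e) = v} r(e)`, for every vertex `v` that emits edges, on the
free commutative monoid over the vertices. -/
def Rel (E : RowFiniteGraph) (x y : E.Vertex →₀ ℕ) : Prop :=
  ∃ v, {e | E.src e = v}.Nonempty ∧ x = Finsupp.single v 1 ∧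
    y = ∑ e ∈ (E.row_finite v).toFinset, Finsupp.single (E.rng e) 1

/-- The graph monoid `M(E)`. -/
abbrev Monoid (E : RowFiniteGraph) := (addConGen E.Rel).Quotient

end RowFiniteGraph

/-- `M` is isomorphic to the monoid of some (countable) row-finite graph. -/
def IsGraphMonoid (M : Type*) [AddCommMonoid M] : Prop :=
  ∃ E : RowFiniteGraph, Nonempty (M ≃+ E.Monoid)

/-! ### The poset `{p, q_1, …, q_r}` and systems on it -/

/-- The poset `{p, q_1, …, q_r}` with `q_i < p` for all `i` and no other strict relations. -/
inductive Fork (r : ℕ) : Type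
  | p : Fork r
  | q (i : Fin r) : Fork r

namespace Fork

instance instPartialOrder (r : ℕ) : PartialOrder (Fork r) where
  le x y := x = y ∨ y = p
  le_refl x := Or.inl rfl
  le_trans x y z hxy hyz := by
    rcases hyz with rfl | rfl
    · exact hxy
    · exact Or.inr rfl
  le_antisymm x y hxy hyx := by
    rcases hxy with rfl | rfl
    · rfl
    · rcases hyx with h | h
      · exact h.symm
      · exact h

theorem q_lt_p {r : ℕ} (i : Fin r) : (q i : Fork r) < p :=
  lt_of_le_of_ne (Or.inr rfl) (by simp)

theorem eq_p_of_lt {r : ℕ} {x y : Fork r} (h : x < y) : y = p := by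
  rcases h.le with h' | h'
  · exact absurd h' h.ne
  · exact h'

/-- The groups of a system on the poset, all of whose elements are free: `G_p = A`, `G_{q_i} = 0`. -/
def group (r : ℕ) (A : Type) : Fork r → Type
  | p => A
  | q _ => PUnit

instance instAddCommGroupGroup (r : ℕ) (A : Type) [AddCommGroup A] :
    ∀ x : Fork r, AddCommGroup (group r A x)
  | p => inferInstanceAs (AddCommGroup A)
  | q _ => inferInstanceAs (AddCommGroup PUnit)

/-- The family `q_i ↦ x_i` (the value at `p` is irrelevant). -/
def val {r : ℕ} {A : Type} [AddCommGroup A] (x : Fin r → A) : Fork r → A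
  | p => 0
  | q i => x i

/-- The maps `φ_{p, q_i} : M_{q_i} = ℕ → A`, `n ↦ n x_i`. -/
def map {r : ℕ} {A : Type} [AddCommGroup A] (x : Fin r → A) (i : Fork r) :
    ∀ j : Fork r, semigroupPart (i ∈ (Set.univ : Set (Fork r))) (group r A i) →ₙ+ group r A j
  | p =>
    { toFun := fun u => (u.1.1 • val x i : A)
      map_add' := fun u v => add_smul u.1.1 v.1.1 (val x i) }
  | q _ =>
    { toFun := fun _ => PUnit.unit
      map_add' := fun _ _ => rfl }

/-- The system on `{p, q_1, …, q_r}` with all elements free, `G_p = A` and `φ_{p, q_i}(n) = n x_i`,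
where the semigroup generated by the `x_i` is all of `A`. -/
def system {r : ℕ} {A : Type} [AddCommGroup A] (x : Fin r → A)
    (hx : AddSubmonoid.closure (Set.range x) = ⊤) : ISystem.{0, 0} (Fork r) where
  free := Set.univ
  G := group r A
  grp := instAddCommGroupGroup r A
  φ := fun {i j} _ => map x i j
  comp := by
    intro i j k hij hjk
    obtain rfl := eq_p_of_lt hij
    obtain rfl := eq_p_of_lt hjk
    exact absurd hjk (lt_irrefl _)
  surj := by
    rintro (_ | i) -
    · refine top_le_iff.1 ?_
      change (⊤ : AddSubmonoid A) ≤ _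
      rw [← hx]
      refine AddSubmonoid.closure_mono ?_
      rintro _ ⟨i, rfl⟩
      refine ⟨q i, q_lt_p i, ⟨(1, 0), fun _ => Int.one_pos, fun h => absurd trivial h⟩, ?_⟩
      exact one_smul ℤ (x i)
    · refine top_le_iff.1 fun y _ => ?_
      have : y = 0 := rfl
      rw [this]
      exact AddSubmonoid.zero_mem _

/-- The group `ℤ^s ⊕ ℤ_{k_1} ⊕ ⋯ ⊕ ℤ_{k_{r-s}}`. -/
abbrev ExGroup (r s : ℕ) (k : Fin (r - s) → ℕ) : Type :=
  (Fin s → ℤ) × (∀ j : Fin (r - s), ZMod (k j))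

/-- The elements `φ_{p, q_i}(1)`: the `i`-th basis vector of `ℤ^s` for the first `s` indices, and
`(-1, …, -1, 0, …, 0, 1, 0, …, 0)`, with the `1` in the component `ℤ_{k_{i-s}}`, for the others. -/
def exVal (r s : ℕ) (k : Fin (r - s) → ℕ) (i : Fin r) : ExGroup r s k :=
  if h : (i : ℕ) < s then (Pi.single ⟨i, h⟩ 1, 0)
  else (fun _ => -1, Pi.single ⟨i - s, by omega⟩ 1)

theorem closure_exVal {r s : ℕ} (hs : s < r) (k : Fin (r - s) → ℕ) (hk : ∀ j, 1 ≤ k j) :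
    AddSubmonoid.closure (Set.range (exVal r s k)) = ⊤ := by
  have hk' : ∀ j, NeZero (k j) := fun j => ⟨by have := hk j; omega⟩
  set S := AddSubmonoid.closure (Set.range (exVal r s k)) with hS
  have hlow : ∀ l : Fin s, ((Pi.single l 1, 0) : ExGroup r s k) ∈ S := by
    intro l
    refine AddSubmonoid.subset_closure ⟨⟨l, by omega⟩, ?_⟩
    simp [exVal]
  have hhigh : ∀ j : Fin (r - s), ((fun _ => -1, Pi.single j 1) : ExGroup r s k) ∈ S := by
    intro j
    refine AddSubmonoid.subset_closure ⟨⟨s + j, by omega⟩, ?_⟩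
    have hj : ∀ (m : ℕ) (hm : m < r - s), m = j →
        (Pi.single ⟨m, hm⟩ 1 : ∀ j : Fin (r - s), ZMod (k j)) = Pi.single j 1 := by
      rintro m hm rfl; rfl
    simp only [exVal, Nat.not_lt.2 (Nat.le_add_right s j), dite_false]
    rw [hj _ _ (by simp)]
  have hpos : ∀ a : Fin s → ℤ, (∀ l, 0 ≤ a l) → ((a, 0) : ExGroup r s k) ∈ S := by
    intro a ha
    have h1 : ((a, 0) : ExGroup r s k) =
        ∑ l, (a l).toNat • ((Pi.single l 1, 0) : ExGroup r s k) := by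
      refine Prod.ext ?_ ?_
      · rw [Prod.fst_sum]
        funext m
        rw [Finset.sum_apply]
        simp [Pi.single_apply, ha m]
      · simp [Prod.snd_sum]
    rw [h1]
    exact AddSubmonoid.sum_mem _ fun l _ => AddSubmonoid.nsmul_mem _ (hlow l) _
  have hint : ∀ a : Fin s → ℤ, ((a, 0) : ExGroup r s k) ∈ S := by
    intro a
    let j : Fin (r - s) := ⟨0, by omega⟩
    let m : ℕ := ∑ l, (a l).natAbs
    have h1 : ((a, 0) : ExGroup r s k) = (fun l => a l + (m * k j : ℕ), 0) +
        (m * k j) • ((fun _ => -1, Pi.single j 1) : ExGroup r s k) := by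
      refine Prod.ext ?_ ?_
      · funext l; simp
      · simp only [Prod.snd_add, Prod.smul_snd, zero_add]
        rw [← Pi.single_smul, nsmul_eq_mul]
        simp
    rw [h1]
    refine AddSubmonoid.add_mem _ (hpos _ fun l => ?_) (AddSubmonoid.nsmul_mem _ (hhigh j) _)
    have h2 : (a l).natAbs ≤ m :=
      Finset.single_le_sum (f := fun l => (a l).natAbs) (fun _ _ => Nat.zero_le _)
        (Finset.mem_univ l)
    have h3 : m ≤ m * k j := Nat.le_mul_of_pos_right _ (hk j)
    omega
  refine top_le_iff.1 fun y _ => ?_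
  obtain ⟨a, b⟩ := y
  have h1 : ((a, b) : ExGroup r s k) = (fun l => a l + ∑ j, ((b j).val : ℤ), 0) +
      ∑ j, (b j).val • ((fun _ => -1, Pi.single j 1) : ExGroup r s k) := by
    refine Prod.ext ?_ ?_
    · simp only [Prod.fst_add, Prod.fst_sum]
      funext l
      rw [Pi.add_apply, Finset.sum_apply]
      simp only [Prod.smul_fst, Pi.smul_apply]
      simp only [nsmul_eq_mul, mul_neg, mul_one, Finset.sum_neg_distrib, add_neg_cancel_right]
    · simp only [Prod.snd_add, Prod.snd_sum, zero_add]
      funext m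
      rw [Finset.sum_apply]
      rw [Finset.sum_eq_single m]
      · simp only [Prod.smul_snd, Pi.smul_apply, Pi.single_eq_same]
        rw [nsmul_eq_mul, mul_one]
        exact (ZMod.natCast_zmod_val (b m)).symm
      · intro j _ hj
        simp only [Prod.smul_snd, Pi.smul_apply, Pi.single_eq_of_ne (Ne.symm hj), smul_zero]
      · intro h; exact absurd (Finset.mem_univ m) h
  rw [h1]
  exact AddSubmonoid.add_mem _ (hint _)
    (AddSubmonoid.sum_mem _ fun j _ => AddSubmonoid.nsmul_mem _ (hhigh j) _)

/-- The system with `G_p = ℤ^s ⊕ ℤ_{k_1} ⊕ ⋯ ⊕ ℤ_{k_{r-s}}` and the maps above. -/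
def exSystem {r s : ℕ} (hs : s < r) (k : Fin (r - s) → ℕ) (hk : ∀ j, 1 ≤ k j) :
    ISystem.{0, 0} (Fork r) :=
  system (exVal r s k) (closure_exVal hs k hk)

end Fork

/-! ### Presentations of the monoids of fork systems -/

/-! Write `x i` for the image of `1 ∈ M_{q_i}` in `A = G_p`, and let `K ⊆ ℤ^r` be the group of
relations between the `x i`. Everything reduces to one criterion: the monoid is a graph monoid if
and only if `K` is cyclic.

Since the `x i` generate `A` already as a monoid, every class comes from `ℕ^r × ℕ`, where the last
coordinate (the level) is the multiplicity of `p`. At level zero nothing is identified; at a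
positive level two elements agree exactly when their levels and their values `∑ c_i x_i` do.

If the monoid comes from a graph, an element of level one contains exactly one vertex of level one,
and the relation at that vertex replaces it by another vertex of level one plus a level-zero offset
in `ℕ^r`. Other relations applicable at level one change neither that vertex nor the total offset.
So the relations run a deterministic dynamics on pairs (vertex, offset) that commutes with
translations, and congruent elements have a common future. Each nonnegative relation `w` thus gives
coinciding futures of `(v, 0)` and `(v, w)`. The difference of the two times determines `w`, so the
possible translations form a cyclic group, and nonnegative relations generate `K`.

Conversely, `K` contains a strictly positive vector, so a cyclic `K` has a generator `n` with all `n
i > 0`; the graph with a loop at one vertex and `n i` edges to the `i`-th sink then works.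

For `r = 1` the group `K ⊆ ℤ` is always cyclic; `K = ⟨n⟩` amounts to the isomorphism in (b); in (c)
`K` contains `r - s` independent relations, and for `s = r - 1` it is determined by its last
coordinate. -/

/-- The subgroup of integral relations between the elements of a finite family. -/
def relationSubgroup {r : ℕ} {A : Type*} [AddCommGroup A] (x : Fin r → A) :
    AddSubgroup (Fin r → ℤ) :=
  (Fintype.linearCombination ℤ x).toAddMonoidHom.ker

theorem mem_relationSubgroup {r : ℕ} {A : Type*} [AddCommGroup A] {x : Fin r → A}
    {c : Fin r → ℤ} : c ∈ relationSubgroup x ↔ ∑ i, c i • x i = 0 := by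
  simp [relationSubgroup, AddMonoidHom.mem_ker, Fintype.linearCombination_apply]

/-- `ψ` presents `M` as the disjoint union of `ℕ^r` (level `0`) and copies of `A`, one for each
positive level, where `ℕ^r` acts on `A` through the family `x`. -/
structure IsForkPresentation {r : ℕ} {A M : Type*} [AddCommGroup A] [AddCommMonoid M]
    (x : Fin r → A) (ψ : (Fin r → ℕ) × ℕ →+ M) : Prop where
  surjective : Function.Surjective ψ
  eq_iff : ∀ a b, ψ a = ψ b ↔
    a.2 = b.2 ∧ ∑ i, a.1 i • x i = ∑ i, b.1 i • x i ∧ (a.2 = 0 → a.1 = b.1)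

/-! ### Monoids of graphs with a fork presentation -/

namespace LevelOne

variable {r : ℕ} {V : Type*}

/-- The position of an element of level one: `x` is the sum of the vertex `s.1` of level one and of
an element of level zero and value `s.2`. -/
def Position (t : (V →₀ ℕ) →+ (Fin r → ℕ) × ℕ) (x : V →₀ ℕ) (s : V × (Fin r → ℤ)) : Prop :=
  ∃ y, x = Finsupp.single s.1 1 + y ∧ (t (Finsupp.single s.1 1)).2 = 1 ∧ (t y).2 = 0 ∧
    s.2 = fun i => ((t y).1 i : ℤ)

variable {t : (V →₀ ℕ) →+ (Fin r → ℕ) × ℕ}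

theorem Position.level {x : V →₀ ℕ} {s : V × (Fin r → ℤ)} (h : Position t x s) : (t x).2 = 1 := by
  obtain ⟨y, rfl, h1, h0, -⟩ := h
  simp [h1, h0]

/-- Levels are natural numbers and add up, so a total of one is carried by a single summand, down to
a single vertex of multiplicity one. -/
theorem exists_position (x : V →₀ ℕ) (hx : (t x).2 = 1) : ∃ s, Position t x s := by
  classical
  induction x using Finsupp.induction_linear with
  | zero => simp at hx
  | add f g hf hg =>
    have h : (t f).2 + (t g).2 = 1 := by simpa using hx
    rcases (by omega : (t f).2 = 1 ∧ (t g).2 = 0 ∨ (t f).2 = 0 ∧ (t g).2 = 1)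
      with ⟨h1, h0⟩ | ⟨h0, h1⟩
    · obtain ⟨s, y, hy, hs, hy0, -⟩ := hf h1
      exact ⟨(s.1, fun i => ((t (y + g)).1 i : ℤ)), y + g, by rw [hy, add_assoc], hs,
        by simp [hy0, h0], rfl⟩
    · obtain ⟨s, y, hy, hs, hy0, -⟩ := hg h1
      exact ⟨(s.1, fun i => ((t (f + y)).1 i : ℤ)), f + y, by rw [hy, add_left_comm], hs,
        by simp [hy0, h0], rfl⟩
  | single v n =>
    have h : n * (t (Finsupp.single v 1)).2 = 1 := by
      rw [← Finsupp.smul_single_one v n, map_nsmul] at hx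
      exact hx
    obtain ⟨rfl, h1⟩ := mul_eq_one.1 h
    exact ⟨(v, _), 0, by simp, h1, by simp, rfl⟩

/-- A second vertex of level one would have to occur in the remainder, whose level is zero. -/
theorem Position.unique {x : V →₀ ℕ} {s s' : V × (Fin r → ℤ)} (h : Position t x s)
    (h' : Position t x s') : s = s' := by
  classical
  obtain ⟨y, rfl, hs, hy, h2⟩ := h
  obtain ⟨y', he, hs', hy', h2'⟩ := h'
  have hv : s.1 = s'.1 := by
    by_contra hne
    have h1 : 0 < y s'.1 := by
      have := DFunLike.congr_fun he s'.1
      simp [hne] at this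
      omega
    have h3 : y = Finsupp.single s'.1 1 + (y - Finsupp.single s'.1 1) :=
      (add_tsub_cancel_of_le (Finsupp.single_le_iff.2 h1)).symm
    rw [h3] at hy
    simp [hs'] at hy
  rw [hv, add_right_inj] at he
  exact Prod.ext hv (by rw [h2, h2', he])

theorem Position.add {x y : V →₀ ℕ} {s : V × (Fin r → ℤ)} (h : Position t x s)
    (hy : (t y).2 = 0) : Position t (x + y) (s.1, s.2 + fun i => ((t y).1 i : ℤ)) := by
  obtain ⟨z, rfl, hs, hz, h2⟩ := h
  exact ⟨z + y, add_assoc _ _ _, hs, by simp [hz, hy], by funext i; simp [h2]⟩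

/-- The action of a vertex map with values in `ℤ^r` on positions. -/
def step (f : V → V × (Fin r → ℤ)) (s : V × (Fin r → ℤ)) : V × (Fin r → ℤ) :=
  ((f s.1).1, (f s.1).2 + s.2)

/-- The next move depends on the vertex alone, so the dynamics commutes with translations of the
offset. -/
theorem iterate_step_translate (f : V → V × (Fin r → ℤ)) (j : ℕ) (v : V) (u w : Fin r → ℤ) :
    (step f)^[j] (v, u + w) = (((step f)^[j] (v, u)).1, ((step f)^[j] (v, u)).2 + w) := by
  induction j with
  | zero => rfl
  | succ j ih =>
    rw [Function.iterate_succ_apply', Function.iterate_succ_apply', ih]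
    simp [step, add_assoc]

theorem iterate_step_eq_translate {f : V → V × (Fin r → ℤ)} {j k : ℕ} {v v' : V}
    {u u' : Fin r → ℤ} (h : (step f)^[j] (v, u) = (step f)^[k] (v', u')) (w : Fin r → ℤ) :
    (step f)^[j] (v, u + w) = (step f)^[k] (v', u' + w) := by
  rw [iterate_step_translate, iterate_step_translate, h]

/-- The subgroup of pairs of a time difference and a translation that preserve the future of the
vertex `v`. -/
def returnSubgroup (f : V → V × (Fin r → ℤ)) (v : V) : AddSubgroup (ℤ × (Fin r → ℤ)) where
  carrier := {g | ∃ j k : ℕ, (j : ℤ) - k = g.1 ∧ (step f)^[j] (v, 0) = (step f)^[k] (v, g.2)}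
  zero_mem' := ⟨0, 0, by simp⟩
  add_mem' := by
    rintro ⟨m, u⟩ ⟨m', u'⟩ ⟨j, k, h, e⟩ ⟨j', k', h', e'⟩
    refine ⟨j' + j, k + k', by push_cast; simp only [Prod.fst_add] at *; omega, ?_⟩
    have e'' := iterate_step_eq_translate e' u
    rw [zero_add] at e''
    rw [Function.iterate_add_apply, e, ← Function.iterate_add_apply, add_comm j' k,
      Function.iterate_add_apply, e'', ← Function.iterate_add_apply, Prod.snd_add, add_comm u' u]
  neg_mem' := by
    rintro ⟨m, u⟩ ⟨j, k, h, e⟩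
    refine ⟨k, j, by simp only [Prod.fst_neg] at *; omega, ?_⟩
    have e' := iterate_step_eq_translate e (-u)
    rw [add_neg_cancel, zero_add] at e'
    exact e'.symm

/-- The time difference embeds this group in `ℤ`: after equally many steps the offsets of `(v, 0)`
and `(v, u)` still differ by `u`, so they coincide only for `u = 0`. -/
theorem isAddCyclic_returnSubgroup (f : V → V × (Fin r → ℤ)) (v : V) :
    IsAddCyclic (returnSubgroup f v) := by
  refine isAddCyclic_of_injective
    ((AddMonoidHom.fst ℤ (Fin r → ℤ)).comp (returnSubgroup f v).subtype) ?_
  rw [injective_iff_map_eq_zero]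
  rintro ⟨⟨m, u⟩, j, k, h, e⟩ (rfl : m = 0)
  obtain rfl : j = k := by simp only at h; omega
  have e' := iterate_step_translate f j v 0 u
  rw [zero_add, ← e] at e'
  have := congrArg Prod.snd e'
  simp only [left_eq_add] at this
  subst this
  rfl

/-- The congruence on the free monoid over the vertices that relates two elements with the same
value whose positions, if of level one, have a common future. -/
def futureCon {A M : Type*} [AddCommGroup A] [AddCommMonoid M] {x : Fin r → A}
    {ψ : (Fin r → ℕ) × ℕ →+ M} (hψ : IsForkPresentation x ψ) (t : (V →₀ ℕ) →+ (Fin r → ℕ) × ℕ)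
    (f : V → V × (Fin r → ℤ)) : AddCon (V →₀ ℕ) where
  r y z := ψ (t y) = ψ (t z) ∧ ∀ s s', Position t y s → Position t z s' →
    ∃ j k : ℕ, (step f)^[j] s = (step f)^[k] s'
  iseqv :=
    { refl := fun y => ⟨rfl, fun s s' h h' => ⟨0, 0, h.unique h'⟩⟩
      symm := fun h => ⟨h.1.symm, fun s s' hs hs' => by
        obtain ⟨j, k, e⟩ := h.2 s' s hs' hs
        exact ⟨k, j, e.symm⟩⟩
      trans := by
        rintro y z w ⟨h1, h2⟩ ⟨h3, h4⟩
        refine ⟨h1.trans h3, fun s s'' hs hs'' => ?_⟩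
        obtain ⟨s', hs'⟩ := exists_position z (((hψ.eq_iff _ _).1 h1).1 ▸ hs.level)
        obtain ⟨j, k, e⟩ := h2 s s' hs hs'
        obtain ⟨j', k', e'⟩ := h4 s' s'' hs' hs''
        refine ⟨j' + j, k + k', ?_⟩
        rw [Function.iterate_add_apply, e, ← Function.iterate_add_apply, add_comm j' k,
          Function.iterate_add_apply, e', ← Function.iterate_add_apply] }
  add' := by
    -- A level-one sum is a level-one summand plus a level-zero one. At level zero `ψ` determines
    -- the vector in `ℕ^r`, so both positions are translated by the same amount.
    have key : ∀ {y z y' z' : V →₀ ℕ}, ψ (t y) = ψ (t z) → (∀ s s', Position t y s →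
        Position t z s' → ∃ j k : ℕ, (step f)^[j] s = (step f)^[k] s') → ψ (t y') = ψ (t z') →
        (t y).2 = 1 → (t y').2 = 0 → ∀ s s', Position t (y + y') s → Position t (z + z') s' →
        ∃ j k : ℕ, (step f)^[j] s = (step f)^[k] s' := by
      intro y z y' z' h1 h2 h3 hy hy' s s' hs hs'
      obtain ⟨hl, -, -⟩ := (hψ.eq_iff _ _).1 h1
      obtain ⟨hl', -, hv⟩ := (hψ.eq_iff _ _).1 h3
      obtain ⟨a, ha⟩ := exists_position y hy
      obtain ⟨b, hb⟩ := exists_position z (hl ▸ hy)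
      obtain ⟨j, k, e⟩ := h2 a b ha hb
      rw [hs.unique (ha.add hy'), hs'.unique (hb.add (hl' ▸ hy')), ← hv hy']
      exact ⟨j, k, iterate_step_eq_translate e _⟩
    rintro y z y' z' ⟨h1, h2⟩ ⟨h3, h4⟩
    refine ⟨by simp only [map_add, h1, h3], fun s s' hs hs' => ?_⟩
    have h : (t y).2 + (t y').2 = 1 := by simpa using hs.level
    rcases (by omega : (t y).2 = 1 ∧ (t y').2 = 0 ∨ (t y).2 = 0 ∧ (t y').2 = 1)
      with ⟨ha, hb⟩ | ⟨ha, hb⟩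
    · exact key h1 h2 h3 ha hb s s' hs hs'
    · rw [add_comm] at hs hs'
      exact key h3 h4 h1 hb ha s s' hs hs'

end LevelOne

open LevelOne in
/-- If a monoid with a fork presentation is a graph monoid, then the relations with nonnegative
coefficients lie in a cyclic group. -/
theorem IsForkPresentation.exists_isAddCyclic {r : ℕ} {A M : Type*} [AddCommGroup A]
    [AddCommMonoid M] {x : Fin r → A} {ψ : (Fin r → ℕ) × ℕ →+ M} (hψ : IsForkPresentation x ψ)
    (hM : IsGraphMonoid M) : ∃ C : AddSubgroup (Fin r → ℤ), IsAddCyclic C ∧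
      ∀ w : Fin r → ℕ, ∑ i, w i • x i = 0 → (fun i => (w i : ℤ)) ∈ C := by
  classical
  obtain ⟨E, ⟨e⟩⟩ := hM
  let π : (E.Vertex →₀ ℕ) →+ E.Monoid := AddCon.mk' _
  choose t₀ ht₀ using fun v => hψ.surjective (e.symm (π (Finsupp.single v 1)))
  let t : (E.Vertex →₀ ℕ) →+ (Fin r → ℕ) × ℕ :=
    Finsupp.liftAddHom fun v => (AddMonoidHom.flip (smulAddHom ℕ _)) (t₀ v)
  have hψt : ∀ y, ψ (t y) = e.symm (π y) := by
    intro y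
    have : ψ.comp t = (e.symm : E.Monoid →+ M).comp π := by
      ext v
      simp [t, ht₀]
    exact DFunLike.congr_fun this y
  have hval : ∀ y z, ψ (t y) = ψ (t z) ↔ addConGen E.Rel y z := by
    intro y z
    rw [hψt, hψt, e.symm.injective.eq_iff]
    exact AddCon.eq _
  have hlift : ∀ m, ∃ y, π y = m := AddCon.mk'_surjective
  let out : E.Vertex → (E.Vertex →₀ ℕ) := fun v =>
    ∑ e ∈ (E.row_finite v).toFinset, Finsupp.single (E.rng e) 1
  have hf : ∀ v, ∃ s : E.Vertex × (Fin r → ℤ), (t (out v)).2 = 1 → Position t (out v) s := by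
    intro v
    by_cases h : (t (out v)).2 = 1
    · obtain ⟨s, hs⟩ := exists_position _ h
      exact ⟨s, fun _ => hs⟩
    -- An arbitrary value: `f` matters only at vertices whose relation lives at level one.
    · exact ⟨(v, 0), fun h' => absurd h' h⟩
  choose f hf using hf
  have hle : addConGen E.Rel ≤ futureCon hψ t f := by
    refine AddCon.addConGen_le.2 ?_
    rintro _ _ ⟨v, hv, rfl, rfl⟩
    have h1 : ψ (t (Finsupp.single v 1)) = ψ (t (out v)) :=
      (hval _ _).2 (AddConGen.Rel.of _ _ ⟨v, hv, rfl, rfl⟩)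
    refine ⟨h1, fun s s' hs hs' => ⟨1, 0, ?_⟩⟩
    have h2 : Position t (Finsupp.single v 1) (v, 0) := ⟨0, by simp, hs.level, by simp, by
      funext i; simp⟩
    rw [hs.unique h2, hs'.unique (hf v hs'.level)]
    simp [step]
  -- Any lift of the class of `(0, 1)` supplies a vertex of level one, which serves as base point
  -- for all relations.
  obtain ⟨y₀, hy₀⟩ := hlift (e (ψ (0, 1)))
  have hy₁ : ψ (t y₀) = ψ (0, 1) := by rw [hψt, hy₀, e.symm_apply_apply]
  obtain ⟨⟨v, u⟩, -, -, hv, -, -⟩ := exists_position y₀ ((hψ.eq_iff _ _).1 hy₁).1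
  have := isAddCyclic_returnSubgroup f v
  refine ⟨(returnSubgroup f v).map (AddMonoidHom.snd _ _), ?_, fun w hw => ?_⟩
  · exact isAddCyclic_of_surjective ((AddMonoidHom.snd ℤ (Fin r → ℤ)).addSubgroupMap _)
      (AddMonoidHom.addSubgroupMap_surjective _ _)
  · obtain ⟨y, hy⟩ := hlift (e (ψ (w, 0)))
    have hy' : ψ (t y) = ψ (w, 0) := by rw [hψt, hy, e.symm_apply_apply]
    obtain ⟨hyl, -, hyw⟩ := (hψ.eq_iff _ _).1 hy'
    -- At level one only the value in `A` counts, and `w` has value zero, so adding `y` changes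
    -- nothing.
    have hrel : ψ (t (Finsupp.single v 1)) = ψ (t (Finsupp.single v 1 + y)) := by
      rw [hψ.eq_iff]
      simp only at hv hyl
      refine ⟨by simp [hyl], ?_, fun h => by omega⟩
      simp [hyw hyl, add_smul, Finset.sum_add_distrib, hw]
    have h2 : Position t (Finsupp.single v 1) (v, 0) := ⟨0, by simp, hv, by simp, by
      funext i; simp⟩
    have h3 := h2.add hyl
    rw [hyw hyl, zero_add] at h3
    obtain ⟨j, k, hjk⟩ := (hle ((hval _ _).1 hrel)).2 _ _ h2 h3
    exact ⟨((j : ℤ) - k, fun i => (w i : ℤ)), ⟨j, k, rfl, hjk⟩, rfl⟩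

/-! ### Positive relations and the graph of a fork -/

/-- If the elements of a family generate a group as a monoid, then they have a relation with
positive coefficients. -/
theorem exists_pos_relation {r : ℕ} {A : Type*} [AddCommGroup A] {x : Fin r → A}
    (hx : AddSubmonoid.closure (Set.range x) = ⊤) :
    ∃ w : Fin r → ℕ, (∀ i, 0 < w i) ∧ ∑ i, w i • x i = 0 := by
  -- Writing this element with nonnegative coefficients and then adding one to each coefficient
  -- gives a strictly positive relation.
  have h : -∑ i, x i ∈ AddSubmonoid.closure (Set.range x) := hx ▸ AddSubmonoid.mem_top _
  obtain ⟨w, hw⟩ := AddSubmonoid.mem_closure_range_iff.1 h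
  refine ⟨fun i => w i + 1, fun i => Nat.succ_pos _, ?_⟩
  rw [Finsupp.sum_fintype _ _ (by simp)] at hw
  simp only [add_smul, one_smul, Finset.sum_add_distrib]
  rw [← hw, neg_add_cancel]

/-- A large multiple of a strictly positive relation makes any integral relation nonnegative. -/
theorem exists_nat_relation_sub {r : ℕ} {A : Type*} [AddCommGroup A] {x : Fin r → A}
    (hx : AddSubmonoid.closure (Set.range x) = ⊤) {c : Fin r → ℤ} (hc : c ∈ relationSubgroup x) :
    ∃ u w : Fin r → ℕ, ∑ i, u i • x i = 0 ∧ ∑ i, w i • x i = 0 ∧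
      c = (fun i => (u i : ℤ)) - fun i => (w i : ℤ) := by
  obtain ⟨w, hw, hw0⟩ := exists_pos_relation hx
  let m : ℕ := ∑ i, (c i).natAbs
  have hm : ∀ i, 0 ≤ c i + m * w i := by
    intro i
    have h1 : (c i).natAbs ≤ m := Finset.single_le_sum (f := fun i => (c i).natAbs)
      (fun _ _ => Nat.zero_le _) (Finset.mem_univ i)
    have h2 : m ≤ m * w i := Nat.le_mul_of_pos_right _ (hw i)
    zify at h1 h2
    have := neg_abs_le (c i)
    omega
  have hmw : ∑ i, (m * w i) • x i = 0 := by
    simp only [mul_smul, ← Finset.smul_sum, hw0, smul_zero]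
  refine ⟨fun i => (c i + m * w i).toNat, fun i => m * w i, ?_, hmw, ?_⟩
  · have h : ∀ i, (c i + m * w i).toNat • x i = c i • x i + (m * w i) • x i := by
      intro i
      rw [← natCast_zsmul, Int.toNat_of_nonneg (hm i), add_smul, ← natCast_zsmul (x i) (m * w i)]
      push_cast
      rfl
    simp only [h, Finset.sum_add_distrib, hmw, mem_relationSubgroup.1 hc, add_zero]
  · funext i
    simp [hm i]

theorem IsForkPresentation.isAddCyclic_relationSubgroup {r : ℕ} {A M : Type*} [AddCommGroup A]
    [AddCommMonoid M] {x : Fin r → A} {ψ : (Fin r → ℕ) × ℕ →+ M} (hψ : IsForkPresentation x ψ)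
    (hx : AddSubmonoid.closure (Set.range x) = ⊤) (hM : IsGraphMonoid M) :
    IsAddCyclic (relationSubgroup x) := by
  obtain ⟨C, hC, hw⟩ := hψ.exists_isAddCyclic hM
  have hle : relationSubgroup x ≤ C := by
    intro c hc
    obtain ⟨u, w, hu, hw', rfl⟩ := exists_nat_relation_sub hx hc
    exact C.sub_mem (hw u hu) (hw w hw')
  exact isAddCyclic_of_injective (AddSubgroup.inclusion hle) (AddSubgroup.inclusion_injective hle)

/-- A strictly positive relation is a multiple of any generator, whose coordinates therefore all
have the same nonzero sign. -/
theorem exists_pos_generator {r : ℕ} {A : Type*} [AddCommGroup A] {x : Fin r → A}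
    (hx : AddSubmonoid.closure (Set.range x) = ⊤) (hK : IsAddCyclic (relationSubgroup x)) :
    ∃ n : Fin r → ℤ, (∀ i, 0 < n i) ∧ relationSubgroup x = AddSubgroup.zmultiples n := by
  obtain ⟨c, hc⟩ := (AddSubgroup.isAddCyclic_iff_exists_zmultiples_eq_top _).1 hK
  obtain ⟨w, hw, hw0⟩ := exists_pos_relation hx
  have hmem : (fun i => (w i : ℤ)) ∈ relationSubgroup x := by
    rw [mem_relationSubgroup]
    simpa only [natCast_zsmul] using hw0
  rw [← hc] at hmem
  obtain ⟨m, hm⟩ := AddSubgroup.mem_zmultiples_iff.1 hmem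
  have hpos : ∀ i, 0 < m * c i := by
    intro i
    have := congrFun hm i
    simp only [Pi.smul_apply, smul_eq_mul] at this
    rw [this]
    exact_mod_cast hw i
  rcases le_total 0 m with h | h
  · exact ⟨c, fun i => pos_of_mul_pos_right (hpos i) h, hc.symm⟩
  · refine ⟨-c, fun i => ?_, by rw [AddSubgroup.zmultiples_neg, hc]⟩
    exact neg_pos.2 (neg_of_mul_pos_right (hpos i) h)

/-- The graph with a vertex `none` that emits a loop and `n i` edges to the sink `some i`. -/
abbrev forkGraph {r : ℕ} (n : Fin r → ℕ) : RowFiniteGraph where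
  Vertex := Option (Fin r)
  Edge := Option (Σ i, Fin (n i))
  countable_vertex := inferInstance
  countable_edge := inferInstance
  src _ := none
  rng e := e.map Sigma.fst
  row_finite _ := Set.toFinite _

/-- The defining relation of a fork graph. -/
def ForkRel {r : ℕ} (n : Fin r → ℕ) (y z : Option (Fin r) →₀ ℕ) : Prop :=
  y = Finsupp.single none 1 ∧ z = Finsupp.single none 1 + ∑ i, n i • Finsupp.single (some i) 1

theorem forkGraph_rel {r : ℕ} (n : Fin r → ℕ) : (forkGraph n).Rel = ForkRel n := by
  have hsum : ∑ e : Option (Σ i, Fin (n i)), Finsupp.single (e.map Sigma.fst) 1 =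
      (Finsupp.single none 1 + ∑ i, n i • Finsupp.single (some i) 1 : Option (Fin r) →₀ ℕ) := by
    rw [Fintype.sum_option]
    simp only [Option.map_none, Option.map_some, Fintype.sum_sigma, Finset.sum_const,
      Finset.card_univ, Fintype.card_fin]
  have huniv : ((forkGraph n).row_finite none).toFinset = Finset.univ :=
    Finset.eq_univ_of_forall fun e => (Set.Finite.mem_toFinset _).2 rfl
  funext y z
  refine propext ⟨?_, ?_⟩
  · rintro ⟨v, ⟨e, rfl⟩, hy, hz⟩
    exact ⟨hy, hz.trans ((congrArg (fun s => ∑ e ∈ s, Finsupp.single (e.map Sigma.fst) 1)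
      huniv).trans hsum)⟩
  · rintro ⟨hy, hz⟩
    exact ⟨none, ⟨none, rfl⟩, hy, hz.trans ((congrArg (fun s => ∑ e ∈ s,
      Finsupp.single (e.map Sigma.fst) 1) huniv).trans hsum).symm⟩

/-- The coordinates of an element of the free monoid over the vertices of a fork graph. -/
def forkCoord (r : ℕ) : (Option (Fin r) →₀ ℕ) →+ (Fin r → ℕ) × ℕ where
  toFun y := (fun i => y (some i), y none)
  map_zero' := rfl
  map_add' _ _ := rfl

theorem forkCoord_surjective (r : ℕ) : Function.Surjective (forkCoord r) := by
  rintro ⟨w, m⟩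
  exact ⟨Finsupp.equivFunOnFinite.symm fun o => o.elim m w, rfl⟩

theorem forkCoord_injective (r : ℕ) : Function.Injective (forkCoord r) := by
  intro y z h
  ext (_ | i)
  · exact congrArg Prod.snd h
  · exact congrFun (congrArg Prod.fst h) i

theorem forkCoord_base (r : ℕ) (n : Fin r → ℕ) (m : ℕ) :
    forkCoord r (Finsupp.single none 1 + m • ∑ i, n i • Finsupp.single (some i) 1) =
      (m • n, 1) := by
  refine Prod.ext (funext fun j => ?_) ?_
  · change (Finsupp.single none 1 + m • ∑ i, n i • Finsupp.single (some i) 1 :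
      Option (Fin r) →₀ ℕ) (some j) = m * n j
    simp [Finsupp.single_apply]
  · change (Finsupp.single none 1 + m • ∑ i, n i • Finsupp.single (some i) 1 :
      Option (Fin r) →₀ ℕ) none = 1
    simp

theorem addConGen_forkRel_smul {r : ℕ} (n : Fin r → ℕ) (m : ℕ) :
    addConGen (ForkRel n) (Finsupp.single none 1 : Option (Fin r) →₀ ℕ)
      (Finsupp.single none 1 + m • ∑ i, n i • Finsupp.single (some i) 1) := by
  induction m with
  | zero => rw [zero_smul, add_zero]; exact (addConGen _).refl _
  | succ m ih =>
    refine (addConGen _).trans ih ?_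
    have h : addConGen (ForkRel n) _ _ := AddConGen.Rel.of _ _ ⟨rfl, rfl⟩
    have h' := (addConGen (ForkRel n)).add h
      ((addConGen (ForkRel n)).refl (m • ∑ i, n i • Finsupp.single (some i) 1))
    rwa [add_assoc, ← succ_nsmul'] at h'

/-- A positive level means that the vertex `none` occurs in `y`; going round its loop `m` times adds
`m • n` to the sinks. -/
theorem addConGen_forkRel_of_coord {r : ℕ} (n : Fin r → ℕ) {y z : Option (Fin r) →₀ ℕ} {m : ℕ}
    (hz : (forkCoord r z).2 = (forkCoord r y).2) (hy : (forkCoord r y).2 ≠ 0)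
    (h : (forkCoord r z).1 = (forkCoord r y).1 + m • n) : addConGen (ForkRel n) y z := by
  have hy' : y = Finsupp.single none 1 + (y - Finsupp.single none 1) :=
    (add_tsub_cancel_of_le (Finsupp.single_le_iff.2 (Nat.one_le_iff_ne_zero.2 hy))).symm
  have hz' : z = Finsupp.single none 1 + m • ∑ i, n i • Finsupp.single (some i) 1 +
      (y - Finsupp.single none 1) := by
    apply forkCoord_injective
    have h1 : forkCoord r (Finsupp.single none 1) = (0, 1) := by
      simpa using forkCoord_base r n 0
    have h2 := congrArg (forkCoord r) hy'
    rw [map_add, h1] at h2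
    rw [map_add, forkCoord_base]
    refine Prod.ext ?_ ?_
    · rw [h, h2]; simp [add_comm]
    · rw [hz, h2]; rfl
  have h' := (addConGen (ForkRel n)).add (addConGen_forkRel_smul n m)
    ((addConGen (ForkRel n)).refl (y - Finsupp.single none 1))
  rwa [← hy', ← hz'] at h'

/-- The presentation and the fork graph induce the same congruence on the free monoid: at a positive
level, equal values mean sink coordinates differing by a multiple of `n`. -/
theorem IsForkPresentation.isGraphMonoid {r : ℕ} {A M : Type*} [AddCommGroup A]
    [AddCommMonoid M] {x : Fin r → A} {ψ : (Fin r → ℕ) × ℕ →+ M} (hψ : IsForkPresentation x ψ)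
    {n : Fin r → ℤ} (hn : ∀ i, 0 < n i) (hK : relationSubgroup x = AddSubgroup.zmultiples n) :
    IsGraphMonoid M := by
  obtain ⟨n, rfl⟩ : ∃ n' : Fin r → ℕ, n = fun i => (n' i : ℤ) :=
    ⟨fun i => (n i).toNat, funext fun i => (Int.toNat_of_nonneg (hn i).le).symm⟩
  have hker : AddCon.ker (ψ.comp (forkCoord r)) = addConGen (ForkRel n) := by
    refine le_antisymm ?_ (AddCon.addConGen_le.2 ?_)
    · intro y z h
      obtain ⟨h1, h2, h3⟩ := (hψ.eq_iff _ _).1 ((AddCon.ker_rel _).1 h)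
      by_cases h0 : (forkCoord r y).2 = 0
      · rw [forkCoord_injective r (Prod.ext (h3 h0) h1)]
        exact (addConGen _).refl _
      · have hmem : (fun i => ((forkCoord r z).1 i : ℤ) - (forkCoord r y).1 i) ∈
            relationSubgroup x := by
          rw [mem_relationSubgroup]
          simp only [sub_smul, natCast_zsmul, Finset.sum_sub_distrib, h2, sub_self]
        rw [hK] at hmem
        obtain ⟨m, hm⟩ := AddSubgroup.mem_zmultiples_iff.1 hmem
        have hm' : ∀ i, m * n i = ((forkCoord r z).1 i : ℤ) - (forkCoord r y).1 i :=
          fun i => congrFun hm i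
        -- The sign of `m` decides which of the two elements is reached from the other through the
        -- loop.
        obtain ⟨k, rfl | rfl⟩ := m.eq_nat_or_neg
        · refine addConGen_forkRel_of_coord n (m := k) h1.symm h0 (funext fun i => ?_)
          have := hm' i
          zify
          simp only [Pi.add_apply, Pi.smul_apply, smul_eq_mul, Nat.cast_add, Nat.cast_mul]
          linarith
        · refine (addConGen _).symm (addConGen_forkRel_of_coord n (m := k) h1 (h1 ▸ h0)
            (funext fun i => ?_))
          have := hm' i
          zify
          simp only [Pi.add_apply, Pi.smul_apply, smul_eq_mul, Nat.cast_add, Nat.cast_mul]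
          linarith
    · intro y z h
      obtain ⟨rfl, rfl⟩ := h
      have hmem : (fun i => (n i : ℤ)) ∈ relationSubgroup x := by
        rw [hK]; exact AddSubgroup.mem_zmultiples _
      rw [mem_relationSubgroup] at hmem
      simp only [natCast_zsmul] at hmem
      have h0 := forkCoord_base r n 0
      have h1 := forkCoord_base r n 1
      rw [zero_smul, zero_smul, add_zero] at h0
      rw [one_smul, one_smul] at h1
      rw [AddCon.ker_rel, AddMonoidHom.comp_apply, AddMonoidHom.comp_apply, h0, h1, hψ.eq_iff]
      simp [hmem]
  refine ⟨forkGraph n, ⟨?_⟩⟩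
  change M ≃+ (addConGen (forkGraph n).Rel).Quotient
  rw [forkGraph_rel, ← hker]
  exact (AddCon.quotientKerEquivOfSurjective (ψ.comp (forkCoord r))
    (hψ.surjective.comp (forkCoord_surjective r))).symm

/-! ### The presentation of the monoid of a fork system -/

namespace Fork

theorem lt_p_iff {r : ℕ} {x : Fork r} : x < p ↔ ∃ i, x = q i := by
  refine ⟨fun h => ?_, ?_⟩
  · rcases x with _ | i
    · exact absurd h (lt_irrefl _)
    · exact ⟨i, rfl⟩
  · rintro ⟨i, rfl⟩
    exact q_lt_p i

theorem not_lt_q {r : ℕ} {x : Fork r} {i : Fin r} : ¬ x < q i := fun h => by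
  cases eq_p_of_lt h

theorem isMax_p_iff {r : ℕ} (a : FGLowerSet (Fork r)) : a.IsMax p ↔ p ∈ a.set :=
  ⟨fun h => h.1, fun h => ⟨h, fun _ _ _ => Or.inr rfl⟩⟩

theorem isMax_q_iff {r : ℕ} (a : FGLowerSet (Fork r)) (i : Fin r) :
    a.IsMax (q i) ↔ q i ∈ a.set ∧ p ∉ a.set := by
  refine ⟨fun h => ⟨h.1, fun hp => ?_⟩, fun h => ⟨h.1, fun y hy _ => ?_⟩⟩
  · rcases h.2 hp (Or.inr rfl) with h | h <;> cases h
  · rcases y with _ | j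
    · exact absurd hy h.2
    · rcases ‹q i ≤ q j› with h | h
      · exact h ▸ le_rfl
      · cases h

instance instFinite (r : ℕ) : Finite (Fork r) :=
  Finite.of_surjective (fun o : Option (Fin r) => o.elim p q) (by
    rintro (_ | i)
    · exact ⟨none, rfl⟩
    · exact ⟨some i, rfl⟩)

/-- The support of an element of `ℕ^r × ℕ` (level last) in the fork. -/
def lowerSupport {r : ℕ} (y : (Fin r → ℕ) × ℕ) : FGLowerSet (Fork r) where
  set := ⟨{x | 0 < y.2 ∨ ∃ i, x = q i ∧ 0 < y.1 i}, by
    rintro x z hzx (h | ⟨i, rfl, h⟩)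
    · exact Or.inl h
    · rcases hzx with rfl | h'
      · exact Or.inr ⟨i, rfl, h⟩
      · cases h'⟩
  fg := ⟨_, Set.toFinite _, (LowerSet.lowerClosure _).symm⟩

theorem p_mem_lowerSupport {r : ℕ} {y : (Fin r → ℕ) × ℕ} :
    p ∈ (lowerSupport y).set ↔ 0 < y.2 := by
  refine ⟨?_, Or.inl⟩
  rintro (h | ⟨i, h, -⟩)
  · exact h
  · cases h

theorem q_mem_lowerSupport {r : ℕ} {y : (Fin r → ℕ) × ℕ} {i : Fin r} :
    q i ∈ (lowerSupport y).set ↔ 0 < y.2 ∨ 0 < y.1 i := by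
  refine or_congr_right ⟨?_, fun h => ⟨i, rfl, h⟩⟩
  rintro ⟨j, h, hj⟩
  cases h
  exact hj

theorem lowerSet_ext {r : ℕ} {a b : FGLowerSet (Fork r)} (hp : p ∈ a.set ↔ p ∈ b.set)
    (hq : ∀ i, q i ∈ a.set ↔ q i ∈ b.set) : a = b := by
  refine FGLowerSet.ext_set (SetLike.ext ?_)
  rintro (_ | i)
  · exact hp
  · exact hq i

theorem lowerSupport_zero (r : ℕ) : lowerSupport (0 : (Fin r → ℕ) × ℕ) = 0 := by
  refine lowerSet_ext ?_ fun i => ?_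
  · rw [p_mem_lowerSupport, FGLowerSet.set_zero]; simp
  · rw [q_mem_lowerSupport, FGLowerSet.set_zero]; simp

theorem lowerSupport_add {r : ℕ} (y z : (Fin r → ℕ) × ℕ) :
    lowerSupport (y + z) = lowerSupport y + lowerSupport z := by
  refine lowerSet_ext ?_ fun i => ?_
  · rw [FGLowerSet.set_add, LowerSet.mem_sup_iff]
    simp only [p_mem_lowerSupport, Prod.snd_add]
    omega
  · rw [FGLowerSet.set_add, LowerSet.mem_sup_iff]
    simp only [q_mem_lowerSupport, Prod.snd_add, Prod.fst_add, Pi.add_apply]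
    omega

end Fork

namespace ISystem

variable {r : ℕ} (J : ISystem (Fork r)) (hJ : J.free = Set.univ)

/-- The elements `φ_{p, q_i}(1)` of `G_p`. -/
def forkVal (i : Fin r) : J.G Fork.p :=
  J.φ (Fork.q_lt_p i) (J.gen (Fork.q i) (hJ ▸ Set.mem_univ _))

/-- Each `q i` is free and minimal, so only the empty sum is available to generate its group. -/
theorem subsingleton_q (hJ : J.free = Set.univ) (i : Fin r) : Subsingleton (J.G (Fork.q i)) := by
  have h := J.surj (Fork.q i) (hJ ▸ Set.mem_univ _)
  rw [show {y : J.G (Fork.q i) | ∃ (k : Fork r) (h : k < Fork.q i) (x : J.Mi k), J.φ h x = y} = ∅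
    from Set.eq_empty_of_forall_notMem fun y ⟨k, hk, _⟩ => Fork.not_lt_q hk,
    AddSubmonoid.closure_empty] at h
  have h0 : ∀ y : J.G (Fork.q i), y = 0 := fun y =>
    AddSubmonoid.mem_bot.1 (h.symm ▸ AddSubmonoid.mem_top y)
  exact ⟨fun y z => (h0 y).trans (h0 z).symm⟩

theorem hatExtension_forkVal (i : Fin r) (u : J.Ghat (Fork.q i)) :
    hatExtension (J.φ (Fork.q_lt_p i)) u = u.1.1 • J.forkVal hJ i := by
  have := J.subsingleton_q hJ i
  have hi : Fork.q i ∈ J.free := hJ ▸ Set.mem_univ _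
  let e : J.Ghat (Fork.q i) := ⟨(1, 0), fun h => absurd hi h⟩
  have hu : u = u.1.1 • e := Subtype.ext (Prod.ext (by simp [e]) (Subsingleton.elim _ _))
  rw [hu, map_zsmul, hatExtension_apply_coe _ e (J.gen (Fork.q i) hi) rfl]
  congr 1
  simp [e]

theorem closure_forkVal : AddSubmonoid.closure (Set.range (J.forkVal hJ)) = ⊤ := by
  refine top_le_iff.1 ?_
  rw [← J.surj Fork.p (hJ ▸ Set.mem_univ _), AddSubmonoid.closure_le]
  rintro _ ⟨k, hk, y, rfl⟩
  obtain ⟨i, rfl⟩ := Fork.lt_p_iff.1 hk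
  have hi : Fork.q i ∈ J.free := hJ ▸ Set.mem_univ _
  let u : J.Ghat (Fork.q i) := ⟨y, fun h => absurd hi h⟩
  rw [← hatExtension_apply_coe (J.φ hk) u y rfl, J.hatExtension_forkVal hJ]
  have hy : 0 < y.1.1 := y.2.1 hi
  obtain ⟨m, hm⟩ := Int.eq_ofNat_of_zero_le hy.le
  simp only [u, hm, natCast_zsmul]
  exact AddSubmonoid.nsmul_mem _ (AddSubmonoid.subset_closure (Set.mem_range_self i)) m

open Classical in
/-- The family with entry `(n, g)` at `p` and `c i` at `q i`. -/
noncomputable def forkFamily (c : Fin r → ℤ) (n : ℤ) (g : J.G Fork.p) : J.Ambient :=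
  DFinsupp.single Fork.p (n, g) + ∑ i, DFinsupp.single (Fork.q i) (c i, 0)

variable {J}

theorem forkFamily_p (c : Fin r → ℤ) (n : ℤ) (g : J.G Fork.p) :
    J.forkFamily c n g Fork.p = (n, g) := by
  classical
  rw [forkFamily, DFinsupp.add_apply, DFinsupp.single_apply, dif_pos rfl, DFinsupp.finsetSum_apply,
    Finset.sum_eq_zero fun i _ => DFinsupp.single_eq_of_ne (by simp), add_zero]

theorem forkFamily_q (c : Fin r → ℤ) (n : ℤ) (g : J.G Fork.p) (i : Fin r) :
    J.forkFamily c n g (Fork.q i) = (c i, 0) := by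
  classical
  rw [forkFamily, DFinsupp.add_apply, DFinsupp.single_eq_of_ne (by simp), zero_add,
    DFinsupp.finsetSum_apply, Finset.sum_eq_single i]
  · exact DFinsupp.single_eq_same
  · intro j _ hj
    exact DFinsupp.single_eq_of_ne (by simpa using hj.symm)
  · intro h
    exact absurd (Finset.mem_univ i) h

theorem ext_forkFamily (hJ : J.free = Set.univ) {z z' : J.Ambient}
    (hp : z Fork.p = z' Fork.p) (hq : ∀ i, (z (Fork.q i)).1 = (z' (Fork.q i)).1) : z = z' := by
  refine DFinsupp.ext ?_
  rintro (_ | i)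
  · exact hp
  · have := J.subsingleton_q hJ i
    exact Prod.ext (hq i) (Subsingleton.elim _ _)

/-- The value of a family in `ℤ × G_p`, to which all entries are pushed. -/
def forkSum (hJ : J.free = Set.univ) : J.Ambient →+ ℤ × J.G Fork.p where
  toFun z := ((z Fork.p).1, (z Fork.p).2 + ∑ i, (z (Fork.q i)).1 • J.forkVal hJ i)
  map_zero' := by simp
  map_add' z z' := by
    simp only [DFinsupp.add_apply, Prod.fst_add, Prod.snd_add, add_smul, Finset.sum_add_distrib,
      Prod.mk_add_mk]
    rw [add_add_add_comm]

theorem forkSum_apply (z : J.Ambient) : forkSum hJ z =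
    ((z Fork.p).1, (z Fork.p).2 + ∑ i, (z (Fork.q i)).1 • J.forkVal hJ i) := rfl

theorem U_le_ker_forkSum (a : FGLowerSet (Fork r)) : J.U a ≤ (forkSum hJ).ker := by
  classical
  refine (AddSubgroup.closure_le _).2 ?_
  rintro _ ⟨i, j, h, -, u, rfl⟩
  obtain rfl := Fork.eq_p_of_lt h
  obtain ⟨i, rfl⟩ := Fork.lt_p_iff.1 h
  rw [SetLike.mem_coe, AddMonoidHom.mem_ker, forkSum_apply, J.hatExtension_forkVal hJ]
  have h1 : ∀ j, (((DFinsupp.single (Fork.q i) (u : ℤ × J.G (Fork.q i)) -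
      DFinsupp.single Fork.p ((0 : ℤ), u.1.1 • J.forkVal hJ i) : J.Ambient) (Fork.q j)).1 : ℤ) =
      if j = i then u.1.1 else 0 := by
    intro j
    rw [DFinsupp.sub_apply, DFinsupp.single_eq_of_ne (i := Fork.p) (by simp), sub_zero]
    split_ifs with hj
    · subst hj
      rw [DFinsupp.single_eq_same]
    · rw [DFinsupp.single_eq_of_ne (by simpa using hj)]
      rfl
  have h2 : (DFinsupp.single (Fork.q i) (u : ℤ × J.G (Fork.q i)) -
      DFinsupp.single Fork.p ((0 : ℤ), u.1.1 • J.forkVal hJ i) : J.Ambient) Fork.p =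
      (0, -(u.1.1 • J.forkVal hJ i)) := by
    rw [DFinsupp.sub_apply, DFinsupp.single_eq_of_ne (by simp), zero_sub, DFinsupp.single_eq_same]
    simp
  simp only [h1, h2, ite_smul, zero_smul, Finset.sum_ite_eq', Finset.mem_univ, if_true,
    neg_add_cancel, Prod.mk_zero_zero]

/-- Every generator needs a maximal element with something below it, which can only be `p`; this is
why level zero stays free. -/
theorem U_eq_bot {a : FGLowerSet (Fork r)} (ha : Fork.p ∉ a.set) : J.U a = ⊥ := by
  classical
  rw [eq_bot_iff]
  refine (AddSubgroup.closure_le _).2 ?_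
  rintro _ ⟨i, j, h, hj, -, -⟩
  obtain rfl := Fork.eq_p_of_lt h
  exact absurd hj.1 ha

/-- Modulo `U a` every entry at `q i` can be pushed to `p`, after which `forkSum` is the only entry
left. -/
theorem mem_U_iff {a : FGLowerSet (Fork r)} (ha : Fork.p ∈ a.set) {z : J.Ambient} :
    z ∈ J.U a ↔ forkSum hJ z = 0 := by
  classical
  refine ⟨fun h => U_le_ker_forkSum hJ a h, fun h => ?_⟩
  rw [forkSum_apply, Prod.mk_eq_zero] at h
  have hz : z = ∑ i, (DFinsupp.single (Fork.q i) ((z (Fork.q i)).1, 0) -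
      DFinsupp.single Fork.p (0, (z (Fork.q i)).1 • J.forkVal hJ i)) := by
    have h1 : z = J.forkFamily (fun i => (z (Fork.q i)).1) (z Fork.p).1 (z Fork.p).2 :=
      ext_forkFamily hJ (by rw [forkFamily_p]) fun i => by rw [forkFamily_q]
    have h2 : ((z Fork.p).1, (z Fork.p).2) =
        -∑ i, ((0 : ℤ), (z (Fork.q i)).1 • J.forkVal hJ i) := by
      refine Prod.ext ?_ ?_
      · simp [Prod.fst_sum, h.1]
      · rw [Prod.snd_neg, Prod.snd_sum]
        exact eq_neg_of_add_eq_zero_left h.2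
    conv_lhs => rw [h1, forkFamily, h2, DFinsupp.single_neg]
    rw [Finset.sum_sub_distrib, sub_eq_neg_add]
    congr 2
    exact map_sum (DFinsupp.singleAddHom (fun i => ℤ × J.G i) Fork.p) _ _
  rw [hz]
  refine AddSubgroup.sum_mem _ fun i _ => AddSubgroup.subset_closure
    ⟨Fork.q i, Fork.p, Fork.q_lt_p i, (Fork.isMax_p_iff a).2 ha,
      ⟨((z (Fork.q i)).1, 0), fun h => absurd (hJ ▸ Set.mem_univ _) h⟩, ?_⟩
  rw [J.hatExtension_forkVal hJ]

theorem mem_Mi_iff (hJ : J.free = Set.univ) {x : Fork r} {u : ℤ × J.G x} :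
    u ∈ J.Mi x ↔ 0 < u.1 :=
  have hx : x ∈ J.free := hJ ▸ Set.mem_univ _
  ⟨fun h => h.1 hx, fun h => ⟨fun _ => h, fun h' => absurd hx h'⟩⟩

theorem forkFamily_mem_H (hJ : J.free = Set.univ) (y : (Fin r → ℕ) × ℕ) :
    J.forkFamily (fun i => (y.1 i : ℤ)) y.2 0 ∈ J.H (Fork.lowerSupport y) := by
  refine ⟨?_, ?_, ?_⟩
  · rintro (_ | i) h
    · rw [Fork.p_mem_lowerSupport] at h
      rw [forkFamily_p]
      exact Prod.ext (by simp; omega) rfl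
    · rw [Fork.q_mem_lowerSupport] at h
      rw [forkFamily_q]
      exact Prod.ext (by simp; omega) rfl
  · rintro (_ | i) h
    · rw [Fork.isMax_p_iff, Fork.p_mem_lowerSupport] at h
      rw [mem_Mi_iff hJ, forkFamily_p]
      exact Int.natCast_pos.2 h
    · rw [Fork.isMax_q_iff, Fork.p_mem_lowerSupport, Fork.q_mem_lowerSupport] at h
      rw [mem_Mi_iff hJ, forkFamily_q]
      exact Int.natCast_pos.2 (h.1.resolve_left h.2)
  · rintro (_ | i) -
    · rw [mem_Mi_iff hJ, forkFamily_p]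
      rcases Nat.eq_zero_or_pos y.2 with h | h
      · exact Or.inl (by rw [h]; rfl)
      · exact Or.inr (Int.natCast_pos.2 h)
    · rw [mem_Mi_iff hJ, forkFamily_q]
      rcases Nat.eq_zero_or_pos (y.1 i) with h | h
      · exact Or.inl (by rw [h]; rfl)
      · exact Or.inr (Int.natCast_pos.2 h)

/-- The homomorphism from `ℕ^r × ℕ` that sends the basis vectors to the generators of the monoid. -/
noncomputable def forkHom (hJ : J.free = Set.univ) : (Fin r → ℕ) × ℕ →+ J.Monoid :=
  (AddCon.mk' J.con).comp
    { toFun := fun y => ⟨(Fork.lowerSupport y, J.forkFamily (fun i => (y.1 i : ℤ)) y.2 0),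
        forkFamily_mem_H hJ y⟩
      map_zero' := Subtype.ext (Prod.ext (Fork.lowerSupport_zero r)
        (ext_forkFamily hJ (by rw [forkFamily_p]; rfl) fun i => by rw [forkFamily_q]; rfl))
      map_add' := fun y z => Subtype.ext (Prod.ext (Fork.lowerSupport_add y z) (by
        refine ext_forkFamily hJ ?_ fun i => ?_
        · change _ = (J.forkFamily _ _ _ + J.forkFamily _ _ _ : J.Ambient) Fork.p
          rw [DFinsupp.add_apply]
          simp [forkFamily_p]
        · change _ = ((J.forkFamily _ _ _ + J.forkFamily _ _ _ : J.Ambient) (Fork.q i)).1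
          rw [DFinsupp.add_apply]
          simp [forkFamily_q])) }

theorem forkHom_eq_iff (y z : (Fin r → ℕ) × ℕ) : forkHom hJ y = forkHom hJ z ↔
    Fork.lowerSupport y = Fork.lowerSupport z ∧
      J.forkFamily (fun i => (y.1 i : ℤ)) y.2 0 - J.forkFamily (fun i => (z.1 i : ℤ)) z.2 0 ∈
        J.U (Fork.lowerSupport y) :=
  AddCon.eq _

theorem forkSum_forkFamily (c : Fin r → ℤ) (n : ℤ) (g : J.G Fork.p) :
    forkSum hJ (J.forkFamily c n g) = (n, g + ∑ i, c i • J.forkVal hJ i) := by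
  simp only [forkSum_apply, forkFamily_p, forkFamily_q]

theorem isForkPresentation_forkHom :
    IsForkPresentation (M := J.Monoid) (J.forkVal hJ) (forkHom hJ) where
  surjective := by
    intro m
    obtain ⟨⟨⟨a, z⟩, hz⟩, rfl⟩ := AddCon.mk'_surjective m
    obtain ⟨h0, hmax, hall⟩ : z ∈ J.H a := hz
    have hnn : ∀ x, 0 ≤ (z x).1 := by
      intro x
      by_cases hx : x ∈ a.set
      · rcases hall x hx with h | h
        · rw [h]; rfl
        · exact ((mem_Mi_iff hJ).1 h).le
      · rw [h0 x hx]; rfl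
    by_cases hp : Fork.p ∈ a.set
    · have hpos : 0 < (z Fork.p).1 := (mem_Mi_iff hJ).1 (hmax _ ((Fork.isMax_p_iff a).2 hp))
      have hg : (z Fork.p).2 ∈ AddSubmonoid.closure (Set.range (J.forkVal hJ)) :=
        J.closure_forkVal hJ ▸ AddSubmonoid.mem_top _
      -- The `G_p`-component is a nonnegative combination of the `forkVal`, so it can be moved into
      -- the entries at the `q i`.
      obtain ⟨w, hw⟩ := AddSubmonoid.mem_closure_range_iff_of_fintype.1 hg
      let y : (Fin r → ℕ) × ℕ := (fun i => (z (Fork.q i)).1.toNat + w i, (z Fork.p).1.toNat)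
      have hya : Fork.lowerSupport y = a := by
        have hy2 : 0 < y.2 := by simpa [y] using hpos
        refine Fork.lowerSet_ext (iff_of_true (Fork.p_mem_lowerSupport.2 hy2) hp) fun i =>
          iff_of_true (Fork.q_mem_lowerSupport.2 (Or.inl hy2)) (a.set.lower (Or.inr rfl) hp)
      refine ⟨y, (AddCon.eq _).2 ⟨hya, ?_⟩⟩
      change J.forkFamily (fun i => (y.1 i : ℤ)) y.2 0 - z ∈ J.U (Fork.lowerSupport y)
      rw [hya, mem_U_iff hJ hp, map_sub, forkSum_forkFamily, forkSum_apply, sub_eq_zero]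
      refine Prod.ext ?_ ?_
      · simp [y, hpos.le]
      · simp only [y, Nat.cast_add, Int.toNat_of_nonneg (hnn _), add_smul, natCast_zsmul,
          Finset.sum_add_distrib, zero_add]
        rw [hw, add_comm]
    -- Without `p` the `q i` in the support are all maximal, so their entries are positive and
    -- recover `a`.
    · let y : (Fin r → ℕ) × ℕ := (fun i => (z (Fork.q i)).1.toNat, 0)
      have hya : Fork.lowerSupport y = a := by
        refine Fork.lowerSet_ext (iff_of_false (fun h => ?_) hp) fun i => ?_
        · exact absurd (Fork.p_mem_lowerSupport.1 h) (lt_irrefl 0)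
        · rw [Fork.q_mem_lowerSupport]
          constructor
          · rintro (h | h)
            · exact absurd h (lt_irrefl 0)
            · by_contra hi
              have : 0 < (z (Fork.q i)).1.toNat := h
              rw [h0 _ hi] at this
              exact absurd this (lt_irrefl 0)
          · intro hi
            have := (mem_Mi_iff hJ).1 (hmax _ ((Fork.isMax_q_iff a i).2 ⟨hi, hp⟩))
            exact Or.inr (by simpa [y] using this)
      refine ⟨y, (AddCon.eq _).2 ⟨hya, ?_⟩⟩
      change J.forkFamily (fun i => (y.1 i : ℤ)) y.2 0 - z ∈ J.U (Fork.lowerSupport y)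
      convert AddSubgroup.zero_mem _
      rw [sub_eq_zero]
      refine ext_forkFamily hJ ?_ fun i => ?_
      · rw [forkFamily_p, h0 _ hp]; rfl
      · rw [forkFamily_q]
        exact Int.toNat_of_nonneg (hnn _)
  eq_iff := by
    intro y z
    rw [forkHom_eq_iff]
    constructor
    · rintro ⟨ha, hU⟩
      have h := U_le_ker_forkSum hJ _ hU
      rw [AddMonoidHom.mem_ker, map_sub, forkSum_forkFamily, forkSum_forkFamily, sub_eq_zero,
        Prod.mk.injEq] at h
      refine ⟨by exact_mod_cast h.1, by simpa only [natCast_zsmul, zero_add] using h.2,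
        fun h0 => ?_⟩
      rw [U_eq_bot (by rw [Fork.p_mem_lowerSupport]; omega), AddSubgroup.mem_bot,
        sub_eq_zero] at hU
      funext i
      have hi := DFunLike.congr_fun hU (Fork.q i)
      rw [forkFamily_q, forkFamily_q, Prod.mk.injEq] at hi
      exact_mod_cast hi.1
    · rintro ⟨h2, hs, h0⟩
      by_cases hy : y.2 = 0
      · obtain rfl : y = z := Prod.ext (h0 hy) h2
        exact ⟨rfl, by rw [sub_self]; exact AddSubgroup.zero_mem _⟩
      · have hy' : 0 < y.2 := Nat.pos_of_ne_zero hy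
        refine ⟨Fork.lowerSet_ext ?_ fun i => ?_, ?_⟩
        · rw [Fork.p_mem_lowerSupport, Fork.p_mem_lowerSupport, h2]
        · exact iff_of_true (Fork.q_mem_lowerSupport.2 (Or.inl hy'))
            (Fork.q_mem_lowerSupport.2 (Or.inl (h2 ▸ hy')))
        · rw [mem_U_iff hJ (Fork.p_mem_lowerSupport.2 hy'), map_sub, forkSum_forkFamily,
            forkSum_forkFamily, sub_eq_zero]
          simp only [natCast_zsmul, hs, h2]

end ISystem

/-! ### Graph monoids of fork systems -/

theorem ISystem.isGraphMonoid_iff {r : ℕ} {J : ISystem (Fork r)} (hJ : J.free = Set.univ) :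
    IsGraphMonoid J.Monoid ↔ IsAddCyclic (relationSubgroup (J.forkVal hJ)) := by
  have hψ := J.isForkPresentation_forkHom hJ
  refine ⟨hψ.isAddCyclic_relationSubgroup (J.closure_forkVal hJ), fun h => ?_⟩
  obtain ⟨n, hn, hK⟩ := exists_pos_generator (J.closure_forkVal hJ) h
  exact hψ.isGraphMonoid hn hK

/-- The `x i` generate `A`, so `A` is `ℤ^r` modulo its relations; conversely an isomorphism matching
`x i` with the class of the `i`-th basis vector carries relations to relations. -/
theorem relationSubgroup_eq_zmultiples_iff {r : ℕ} {A : Type*} [AddCommGroup A] {x : Fin r → A}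
    (hx : AddSubmonoid.closure (Set.range x) = ⊤) (n : Fin r → ℤ) :
    relationSubgroup x = AddSubgroup.zmultiples n ↔
      ∃ e : A ≃+ (Fin r → ℤ) ⧸ AddSubgroup.zmultiples n,
        ∀ i, e (x i) = QuotientAddGroup.mk (Pi.single i (1 : ℤ)) := by
  constructor
  · intro h
    have hsurj : Function.Surjective (Fintype.linearCombination ℤ x).toAddMonoidHom := by
      intro a
      have ha : a ∈ AddSubmonoid.closure (Set.range x) := hx ▸ AddSubmonoid.mem_top a
      obtain ⟨w, rfl⟩ := AddSubmonoid.mem_closure_range_iff_of_fintype.1 ha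
      exact ⟨fun i => w i, by simp [Fintype.linearCombination_apply]⟩
    let e := (QuotientAddGroup.quotientAddEquivOfEq h.symm).trans
      (QuotientAddGroup.quotientKerEquivOfSurjective _ hsurj)
    refine ⟨e.symm, fun i => ?_⟩
    rw [AddEquiv.symm_apply_eq]
    change _ = (Fintype.linearCombination ℤ x) (Pi.single i 1)
    rw [Fintype.linearCombination_apply_single, one_smul]
  · rintro ⟨e, he⟩
    ext c
    rw [mem_relationSubgroup, ← e.map_eq_zero_iff, map_sum,
      ← QuotientAddGroup.eq_zero_iff (N := AddSubgroup.zmultiples n) c]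
    have hc : c = ∑ i, c i • Pi.single i (1 : ℤ) := by
      funext j
      simp [Finset.sum_apply, Pi.single_apply]
    have hmk : (QuotientAddGroup.mk' (AddSubgroup.zmultiples n)) c = ∑ i, e (c i • x i) := by
      conv_lhs => rw [hc, map_sum]
      refine Finset.sum_congr rfl fun i _ => ?_
      rw [map_zsmul, map_zsmul, he]
      rfl
    rw [← hmk]
    rfl

theorem isAddCyclic_relationSubgroup_of_fin_one {A : Type*} [AddCommGroup A] (x : Fin 1 → A) :
    IsAddCyclic (relationSubgroup x) := by
  refine isAddCyclic_of_injective
    ((Pi.evalAddMonoidHom (fun _ : Fin 1 => ℤ) 0).comp (relationSubgroup x).subtype) ?_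
  intro c d h
  refine Subtype.ext (funext fun i => ?_)
  rw [Subsingleton.elim i 0]
  exact h

/-- The single generator has finite order, because its negative is a nonnegative multiple of it. -/
theorem finite_and_isAddCyclic_of_closure_fin_one {A : Type*} [AddCommGroup A] {x : Fin 1 → A}
    (hx : AddSubmonoid.closure (Set.range x) = ⊤) : Finite A ∧ IsAddCyclic A := by
  have hmem : ∀ a, a ∈ AddSubgroup.zmultiples (x 0) := by
    intro a
    have ha : a ∈ AddSubmonoid.closure (Set.range x) := hx ▸ AddSubmonoid.mem_top a
    obtain ⟨w, rfl⟩ := AddSubmonoid.mem_closure_range_iff_of_fintype.1 ha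
    rw [Fin.sum_univ_one]
    exact AddSubgroup.nsmul_mem_zmultiples _ _
  obtain ⟨w, hw, hw0⟩ := exists_pos_relation hx
  rw [Fin.sum_univ_one] at hw0
  have hfin : Finite (AddSubgroup.zmultiples (x 0)) :=
    finite_zmultiples.2 (isOfFinAddOrder_iff_nsmul_eq_zero.2 ⟨w 0, hw 0, hw0⟩)
  exact ⟨Finite.of_surjective (AddSubgroup.zmultiples (x 0)).subtype fun a => ⟨⟨a, hmem a⟩, rfl⟩,
    ⟨x 0, hmem⟩⟩

/-! ### The systems with `G_p = ℤ^s ⊕ ℤ_{k_1} ⊕ ⋯ ⊕ ℤ_{k_{r-s}}` -/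

namespace Fork

theorem isGraphMonoid_system_iff {r : ℕ} {A : Type} [AddCommGroup A] (x : Fin r → A)
    (hx : AddSubmonoid.closure (Set.range x) = ⊤) :
    IsGraphMonoid (system x hx).Monoid ↔ IsAddCyclic (relationSubgroup x) := by
  have h : ((system x hx).forkVal rfl : Fin r → A) = x := funext fun i => one_smul ℤ (x i)
  have h' : relationSubgroup ((system x hx).forkVal rfl) = relationSubgroup x :=
    congrArg (relationSubgroup (A := A)) h
  rw [ISystem.isGraphMonoid_iff (J := system x hx) rfl, h']

theorem mem_relationSubgroup_exVal {r s : ℕ} (hs : s < r) (k : Fin (r - s) → ℕ) (c : Fin r → ℤ) :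
    c ∈ relationSubgroup (exVal r s k) ↔
      (∀ l : Fin s, c (l.castLE hs.le) = ∑ i : Fin r, if (i : ℕ) < s then 0 else c i) ∧
        ∀ j : Fin (r - s), (k j : ℤ) ∣ c ⟨s + j, by omega⟩ := by
  rw [mem_relationSubgroup, Prod.ext_iff, funext_iff, funext_iff]
  refine and_congr (forall_congr' fun l => ?_) (forall_congr' fun j => ?_)
  · have h : ∀ i : Fin r, (c i • exVal r s k i).1 l =
        (if i = l.castLE hs.le then c i else 0) - if (i : ℕ) < s then 0 else c i := by
      intro i
      by_cases hi : (i : ℕ) < s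
      · by_cases hl : i = l.castLE hs.le
        · subst hl
          simp [exVal]
        · have hl' : l ≠ ⟨i, hi⟩ := fun h => hl (by subst h; rfl)
          simp [exVal, hi, hl, hl']
      · have hl : i ≠ l.castLE hs.le := fun h => hi (by rw [h]; exact l.2)
        simp [exVal, hi, hl]
    rw [Prod.fst_sum, Finset.sum_apply, Finset.sum_congr rfl fun i _ => h i,
      Finset.sum_sub_distrib, Finset.sum_ite_eq' Finset.univ, if_pos (Finset.mem_univ _)]
    exact sub_eq_zero
  · have h : ∀ i : Fin r, (c i • exVal r s k i).2 j =
        if i = ⟨s + j, by omega⟩ then (c i : ZMod (k j)) else 0 := by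
      intro i
      by_cases hi : i = ⟨s + j, by omega⟩
      · subst hi
        have hj : ∀ (m : ℕ) (hm : m < r - s), m = j →
            (Pi.single ⟨m, hm⟩ 1 : ∀ j : Fin (r - s), ZMod (k j)) j = 1 := by
          rintro m hm rfl
          exact Pi.single_eq_same _ _
        simp only [exVal, Nat.not_lt.2 (Nat.le_add_right s j), dite_false, if_true,
          Prod.smul_snd, Pi.smul_apply]
        rw [hj _ _ (by simp), zsmul_eq_mul, mul_one]
      · by_cases his : (i : ℕ) < s
        · simp [exVal, hi, his]
        · have hj : j ≠ ⟨i - s, by omega⟩ := fun h => hi (Fin.ext (by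
            have := congrArg Fin.val h
            simp only at this ⊢
            omega))
          simp [exVal, hi, his, hj]
    rw [Prod.snd_sum, Finset.sum_apply, Finset.sum_congr rfl fun i _ => h i,
      Finset.sum_ite_eq' Finset.univ, if_pos (Finset.mem_univ _)]
    exact ZMod.intCast_zmod_eq_zero_iff_dvd _ _

theorem isAddCyclic_relationSubgroup_exVal_iff {r s : ℕ} (hs : s < r) (k : Fin (r - s) → ℕ)
    (hk : ∀ j, 1 ≤ k j) : IsAddCyclic (relationSubgroup (exVal r s k)) ↔ s = r - 1 := by
  constructor
  · intro hK
    by_contra hne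
    have hs' : s + 1 < r := by omega
    -- For each torsion summand, `k j` times the element at index `s + j` is `(-k j, …, -k j)` in
    -- `ℤ^s` and is cancelled by `k j` times each of the first `s` elements.
    have hmem : ∀ j : Fin (r - s), (fun i : Fin r => if (i : ℕ) < s ∨ (i : ℕ) = s + j then
        (k j : ℤ) else 0) ∈ relationSubgroup (exVal r s k) := by
      intro j
      refine (mem_relationSubgroup_exVal hs k _).2 ⟨fun l => ?_, fun j' => ?_⟩
      · have h : ∀ i : Fin r, (if (i : ℕ) < s then 0 else
            if (i : ℕ) < s ∨ (i : ℕ) = s + j then (k j : ℤ) else 0) =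
            if i = ⟨s + j, by omega⟩ then (k j : ℤ) else 0 := by
          intro i
          simp only [Fin.ext_iff]
          split_ifs <;> first | rfl | omega
        rw [Finset.sum_congr rfl fun i _ => h i, Finset.sum_ite_eq' Finset.univ,
          if_pos (Finset.mem_univ _)]
        exact if_pos (Or.inl l.2)
      · by_cases hj : j' = j
        · subst hj
          simp
        · have : ¬ (s + (j' : ℕ) < s ∨ s + (j' : ℕ) = s + j) := by
            rw [Fin.ext_iff] at hj
            omega
          simp only [this, if_false, dvd_zero]
    obtain ⟨g, hg⟩ := (AddSubgroup.isAddCyclic_iff_exists_zmultiples_eq_top _).1 hK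
    have h0 := hmem ⟨0, by omega⟩
    have h1 := hmem ⟨1, by omega⟩
    rw [← hg, AddSubgroup.mem_zmultiples_iff] at h0 h1
    obtain ⟨a, ha⟩ := h0
    obtain ⟨b, hb⟩ := h1
    -- Two such relations cannot be multiples of one `g`: at index `s` the first is nonzero and the
    -- second zero, so `g` is nonzero there and `b = 0`, yet the second is nonzero at `s + 1`.
    have ha0 := congrFun ha ⟨s, hs⟩
    have hb0 := congrFun hb ⟨s, hs⟩
    have hb1 := congrFun hb ⟨s + 1, hs'⟩
    have hk0 := hk ⟨0, by omega⟩
    have hk1 := hk ⟨1, by omega⟩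
    simp at ha0 hb0 hb1
    rcases hb0 with rfl | h
    · simp at hb1; omega
    · rw [h, mul_zero] at ha0; omega
  · rintro rfl
    -- With `s = r - 1`, each of the first `s` coordinates of a relation equals the last one, so
    -- evaluation at the last index embeds the relations in `ℤ`.
    refine isAddCyclic_of_injective ((Pi.evalAddMonoidHom (fun _ : Fin r => ℤ) ⟨r - 1, hs⟩).comp
      (relationSubgroup (exVal r (r - 1) k)).subtype) ?_
    rw [injective_iff_map_eq_zero]
    rintro ⟨c, hc⟩ (h : c ⟨r - 1, hs⟩ = 0)
    have hlast : ∀ i : Fin r, ¬ (i : ℕ) < r - 1 → c i = 0 := by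
      intro i hi
      rw [← h]
      congr 1
      exact Fin.ext (by simp only; omega)
    refine Subtype.ext (funext fun i => ?_)
    by_cases hi : (i : ℕ) < r - 1
    · refine (((mem_relationSubgroup_exVal hs k c).1 hc).1 ⟨i, hi⟩).trans
        (Finset.sum_eq_zero fun j _ => ?_)
      split_ifs with hj
      · rfl
      · exact hlast j hj
    · exact hlast i hi

end Fork

theorem mainTheorem10 (r : ℕ) :
    (∀ (J : ISystem (Fork r)) (hJ : J.free = Set.univ),
      (∀ i, Subsingleton (J.G (Fork.q i))) ∧
      (r = 1 → Finite (J.G Fork.p) ∧ IsAddCyclic (J.G Fork.p) ∧ IsGraphMonoid J.Monoid) ∧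
      (1 < r →
        (IsGraphMonoid J.Monoid ↔
          ∃ n : Fin r → ℤ, (∀ i, 0 < n i) ∧
            ∃ e : J.G Fork.p ≃+ (Fin r → ℤ) ⧸ AddSubgroup.zmultiples n,
              ∀ i, e (J.φ (Fork.q_lt_p i) (J.gen (Fork.q i) (hJ ▸ Set.mem_univ _))) =
                QuotientAddGroup.mk (Pi.single i (1 : ℤ))))) ∧
    (1 < r → ∀ (s : ℕ) (hs : s < r) (k : Fin (r - s) → ℕ) (hk : ∀ j, 1 ≤ k j),
      (IsGraphMonoid (Fork.exSystem hs k hk).Monoid ↔ s = r - 1)) := by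
  refine ⟨fun J hJ => ⟨J.subsingleton_q hJ, ?_, fun _ => ?_⟩, fun _ s hs k hk => ?_⟩
  · rintro rfl
    obtain ⟨hfin, hcyc⟩ := finite_and_isAddCyclic_of_closure_fin_one (J.closure_forkVal hJ)
    exact ⟨hfin, hcyc,
      (ISystem.isGraphMonoid_iff hJ).2 (isAddCyclic_relationSubgroup_of_fin_one _)⟩
  · constructor
    · intro h
      obtain ⟨n, hn, hK⟩ := exists_pos_generator (J.closure_forkVal hJ)
        ((ISystem.isGraphMonoid_iff hJ).1 h)
      exact ⟨n, hn, (relationSubgroup_eq_zmultiples_iff (J.closure_forkVal hJ) n).1 hK⟩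
    · rintro ⟨n, hn, he⟩
      exact (J.isForkPresentation_forkHom hJ).isGraphMonoid hn
        ((relationSubgroup_eq_zmultiples_iff (J.closure_forkVal hJ) n).2 he)
  · exact (Fork.isGraphMonoid_system_iff _ _).trans
      (Fork.isAddCyclic_relationSubgroup_exVal_iff hs k hk)
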